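/- **Theorem (Solution to MaxEnDNet).** Let $(\mathbf x^i,\mathbf y^i)$, $i=1,\dots,N$, be training pairs, let $\mathcal Y(\mathbf x)$ be the finite set of admissible labels of an input $\mathbf x$, let $F(\mathbf x,\mathbf y;w)$ be a real discriminant function, measurable in the parameter $w$, let $\Delta\ell_i(\mathbf y)$ be real losses, let $p_0$ be a probability distribution of $w$, and put $\Delta F_i(\mathbf y;w)=F(\mathbf x^i,\mathbf y^i;w)-F(\mathbf x^i,\mathbf y;w)$. Below, $(i,\mathbf y)$ ranges over the pairs with $1\le i\le N$, $\mathbf y\in\mathcal Y(\mathbf x^i)$, $\mathbf y\ne\mathbf y^i$. Let $U:\mathbb R^N\to(-\infty,+\infty]$ be a closed proper convex function, such that for every $M$ there is a $\xi$ with $U(\xi)<\infty$ and $\xi_i\ge M$ for all $i$. Consider the problem $$\text{P1:}\quad \min_{p,\xi}\ \mathrm{KL}(p\,\|\,p_0)+U(\xi)\quad\text{s.t.}\quad \int[\Delta F_i(\mathbf y;w)-\Delta\ell_i(\mathbf y)]\,dp(w)\ge-\xi_i\ \ \forall (i,\mathbf y),\qquad \xi_i\ge 0\ \ \forall i,$$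 over the probability distributions $p$ under which all $\Delta F_i(\mathbf y;\cdot)$ are integrable and the $\xi\in\mathbb R^N$, and the problem $$\text{D1:}\quad \max_{\alpha}\ -\log Z(\alpha)-U^\star(\alpha)\quad\text{s.t.}\quad \alpha_i(\mathbf y)\ge 0\ \ \forall(i,\mathbf y),$$ where $$Z(\alpha)=\int\exp\Big\{\sum_{i,\mathbf y\ne\mathbf y^i}\alpha_i(\mathbf y)[\Delta F_i(\mathbf y;w)-\Delta\ell_i(\mathbf y)]\Big\}\,dp_0(w)\in(0,\infty],\qquad U^\star(\alpha)=\sup_{\xi\ge 0}\Big(\sum_{i,\mathbf y\ne\mathbf y^i}\alpha_i(\mathbf y)\,\xi_i-U(\xi)\Big).$$ If $Z(\alpha)<\infty$, let $p_\alpha$ be the distribution $$dp_\alpha(w)=\frac1{Z(\alpha)}\exp\Big\{\sum_{i,\mathbf y\ne\mathbf y^i}\alpha_i(\mathbf y)[\Delta F_i(\mathbf y;w)-\Delta\ell_i(\mathbf y)]\Big\}\,dp_0(w).$$ A solution of D1 means a maximizer with finite objective. 1. The infimum of P1 equals the supremum of D1 (in $[-\infty,\infty]$), and if it is not $-\infty$,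 then D1 has a solution. 2. If $(p,\xi)$ is a solution of P1 and $\alpha$ is a solution of D1, then $Z(\alpha)<\infty$ and $p=p_\alpha$, and $\alpha_i(\mathbf y)\big(\int[\Delta F_i(\mathbf y;w)-\Delta\ell_i(\mathbf y)]\,dp(w)+\xi_i\big)=0$ for all $(i,\mathbf y)$. 3. Suppose that for every $c\in\mathbb R$ the set $\{\xi\ge0: U(\xi)\le c\}$ is bounded, and that the set $\{\alpha\ge0: Z(\alpha)<\infty\}$ is relatively open in $\{\alpha\ge0\}$ (for instance, $F$ is bounded; or $F$ is linear in $w$ and $p_0$ is Gaussian or Laplace). Then D1 has a solution, and for every solution $\alpha$ of D1 there is a $\xi$ such that $(p_\alpha,\xi)$ is a solution of P1. -/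

import Mathlib

open MeasureTheory
open scoped ENNReal Topology

noncomputable section

/-- A closed proper convex function `U : ℝⁿ → (-∞, ∞]`: its epigraph is convex, it is lower
semicontinuous, it never takes the value `-∞` and it is finite somewhere. -/
structure ClosedProperConvex {ι : Type*} (U : (ι → ℝ) → EReal) : Prop where
  convex_epigraph : Convex ℝ {q : (ι → ℝ) × ℝ | U q.1 ≤ (q.2 : EReal)}
  closed : LowerSemicontinuous U
  ne_bot : ∀ ξ, U ξ ≠ ⊥
  exists_ne_top : ∃ ξ, U ξ ≠ ⊤

/-- The data of a maximum entropy discrimination Markov network: training pairs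
`(x i, y i)`, the finite set `feas x` of admissible labels of an input `x`, the discriminant
function `F x y w`, the losses `loss i y`, the prior distribution `prior` of the parameter `w`
and the slack function `U`. -/
structure MaxEnDNet (X Y W : Type*) [MeasurableSpace W] where
  N : ℕ
  x : Fin N → X
  y : Fin N → Y
  feas : X → Finset Y
  F : X → Y → W → ℝ
  loss : Fin N → Y → ℝ
  prior : Measure W
  U : (Fin N → ℝ) → EReal

namespace MaxEnDNet

variable {X Y W : Type*} [MeasurableSpace W]

open Classical in
/-- The admissible labels of the input `x i` that differ from the true label `y i`. -/
def wrong (P : MaxEnDNet X Y W) (i : Fin P.N) : Finset Y :=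
  (P.feas (P.x i)).filter (fun y => y ≠ P.y i)

/-- The index set of the margin constraints: the pairs `(i, y)` with `y ≠ y i` admissible. -/
abbrev Idx (P : MaxEnDNet X Y W) : Type _ := (i : Fin P.N) × {y : Y // y ∈ P.wrong i}

/-- The bracket `ΔF_i(y; w) - Δℓ_i(y)`, where `ΔF_i(y; w) = F(x i, y i; w) - F(x i, y; w)`. -/
def gap (P : MaxEnDNet X Y W) (j : P.Idx) (w : W) : ℝ :=
  (P.F (P.x j.1) (P.y j.1) w - P.F (P.x j.1) j.2 w) - P.loss j.1 j.2

/-- The pair `(p, ξ)` satisfies the constraints of the primal problem: `p` is a probability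
distribution for which the expected margins exist, `ξ ≥ 0`, and
`E_p[ΔF_i(y; w) - Δℓ_i(y)] ≥ -ξ i` for all `i` and all `y ≠ y i`. -/
structure Feasible (P : MaxEnDNet X Y W) (p : Measure W) (ξ : Fin P.N → ℝ) : Prop where
  prob : IsProbabilityMeasure p
  integrable : ∀ j : P.Idx, Integrable (P.gap j) p
  nonneg : ∀ i, 0 ≤ ξ i
  margin : ∀ j : P.Idx, -ξ j.1 ≤ ∫ w, P.gap j w ∂p

/-- The objective `KL(p ‖ p₀) + U(ξ)` of the primal problem. -/
def primalObjective (P : MaxEnDNet X Y W) (p : Measure W) (ξ : Fin P.N → ℝ) : EReal :=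
  ((InformationTheory.klDiv p P.prior : ℝ≥0∞) : EReal) + P.U ξ

/-- The infimum of the primal problem. -/
def primalValue (P : MaxEnDNet X Y W) : EReal :=
  sInf {v | ∃ p ξ, P.Feasible p ξ ∧ v = P.primalObjective p ξ}

/-- The pair `(p, ξ)` solves the primal problem. -/
def IsPrimalSolution (P : MaxEnDNet X Y W) (p : Measure W) (ξ : Fin P.N → ℝ) : Prop :=
  P.Feasible p ξ ∧ ∀ p' ξ', P.Feasible p' ξ' → P.primalObjective p ξ ≤ P.primalObjective p' ξ'

/-- The exponent `∑_{i, y ≠ y i} α_i(y) [ΔF_i(y; w) - Δℓ_i(y)]`. -/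
def exponent (P : MaxEnDNet X Y W) (α : P.Idx → ℝ) (w : W) : ℝ :=
  ∑ j, α j * P.gap j w

/-- The normalization factor `Z(α) = ∫ exp(∑ α_i(y) [ΔF_i(y; w) - Δℓ_i(y)]) dp₀(w) ∈ [0, ∞]`. -/
def Z (P : MaxEnDNet X Y W) (α : P.Idx → ℝ) : ℝ≥0∞ :=
  ∫⁻ w, ENNReal.ofReal (Real.exp (P.exponent α w)) ∂P.prior

/-- The exponentially tilted distribution `Z(α)⁻¹ exp(∑ α_i(y) [ΔF_i(y; w) - Δℓ_i(y)]) dp₀(w)`. -/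
def gibbs (P : MaxEnDNet X Y W) (α : P.Idx → ℝ) : Measure W :=
  P.prior.withDensity (fun w => (P.Z α)⁻¹ * ENNReal.ofReal (Real.exp (P.exponent α w)))

/-- The conjugate `U⋆(α) = sup_ξ (∑_{i, y ≠ y i} α_i(y) ξ_i - U(ξ))` of the slack function; the
supremum is over the slack vectors, that is, over `ξ ≥ 0`. -/
def conjU (P : MaxEnDNet X Y W) (α : P.Idx → ℝ) : EReal :=
  ⨆ (ξ : Fin P.N → ℝ) (_ : ∀ i, 0 ≤ ξ i), (((∑ j : P.Idx, α j * ξ j.1 : ℝ) : EReal) - P.U ξ)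

/-- The objective `-log Z(α) - U⋆(α)` of the dual problem. -/
def dualObjective (P : MaxEnDNet X Y W) (α : P.Idx → ℝ) : EReal :=
  -(P.Z α).log - P.conjU α

/-- The supremum of the dual problem. -/
def dualValue (P : MaxEnDNet X Y W) : EReal :=
  ⨆ (α : P.Idx → ℝ) (_ : ∀ j, 0 ≤ α j), P.dualObjective α

/-- The multipliers `α` solve the dual problem, with a finite optimal value. -/
def IsDualSolution (P : MaxEnDNet X Y W) (α : P.Idx → ℝ) : Prop :=
  (∀ j, 0 ≤ α j) ∧ P.dualObjective α ≠ ⊥ ∧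
    ∀ β : P.Idx → ℝ, (∀ j, 0 ≤ β j) → P.dualObjective β ≤ P.dualObjective α

/-- The slack function has bounded sublevel sets on the slack vectors `ξ ≥ 0`. -/
def CoerciveSlack (P : MaxEnDNet X Y W) : Prop :=
  ∀ c : ℝ, Bornology.IsBounded {ξ : Fin P.N → ℝ | (∀ i, 0 ≤ ξ i) ∧ P.U ξ ≤ (c : EReal)}

/-- The set `{α ≥ 0 : Z(α) < ∞}` is relatively open in `{α ≥ 0}`. For instance this holds if `F`
is bounded, or if `F` is linear in `w` and the prior is Gaussian or a Laplace distribution. -/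
def RegularZ (P : MaxEnDNet X Y W) : Prop :=
  ∀ α : P.Idx → ℝ, (∀ j, 0 ≤ α j) → P.Z α ≠ ⊤ →
    ∀ᶠ β in 𝓝[{β : P.Idx → ℝ | ∀ j, 0 ≤ β j}] α, P.Z β ≠ ⊤

end MaxEnDNet

end

/-! Weak duality rests on one identity, `primal_sub_dual`: when both objectives are finite, the
primal objective at `(p, ξ)` minus the dual objective at `α` equals `KL(p ‖ p_α)`, plus the Fenchel
gap between `U` and its conjugate, plus the complementary slackness terms. All three are nonnegative
at feasible points. At a pair of solutions their sum is zero, which yields the second claim.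

Strong duality (`exists_le_dualObjective`) applies Lagrange multipliers to a smaller convex program,
whose distributions are bounded densities supported where every gap is bounded. There entropy and
margins are finite real convex functions, and slack vectors with arbitrarily large entries provide a
Slater point. Nothing is lost by the restriction: testing the Lagrangian with the truncated and
normalized density `exp (∑ α_j g_j)` bounds the truncated normalization factors uniformly, and
removing the truncation bounds `Z(α)` itself. Since multipliers exist for the optimal value, the
dual attains it whenever it is finite.

Recovering a primal solution requires the gaps to be integrable under `p_α`, which is not automatic.
Relative openness of the domain of `Z` permits moving from `α` toward any `β ≥ 0`; optimality of
`α`, monotone difference quotients and Fatou's lemma (`integrable_of_le_integral_exp`) then give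
integrability together with a first order inequality. Coercivity makes the conjugate finite in
enough directions to isolate each gap. Finally `ξ` minimizes `U` subject to the margins of `p_α`,
and the first order inequality toward the multipliers of this finite-dimensional problem closes the
duality gap. -/

/-- **Lagrange duality** for finitely many convex inequality constraints on a convex set, under
Slater's condition: a lower bound for the constrained problem is a lower bound for the Lagrangian
at some vector of nonnegative multipliers. -/
theorem exists_lagrange_multipliers {E J : Type*} [AddCommGroup E] [Module ℝ E] [Fintype J]
    {C : Set E} {f : E → ℝ} {h : J → E → ℝ} (hf : ConvexOn ℝ C f)
    (hh : ∀ j, ConvexOn ℝ C (h j)) {x₀ : E} (hx₀ : x₀ ∈ C) (hs : ∀ j, h j x₀ < 0) {v : ℝ}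
    (hv : ∀ x ∈ C, (∀ j, h j x ≤ 0) → v ≤ f x) :
    ∃ α : J → ℝ, (∀ j, 0 ≤ α j) ∧ ∀ x ∈ C, v ≤ f x + ∑ j, α j * h j x := by
  classical
  -- Strict inequalities make `A` a union of open orthants, hence open without any continuity
  -- assumption on `f` or `h`.
  set A : Set ((J → ℝ) × ℝ) := {q | ∃ x ∈ C, (∀ j, h j x < q.1 j) ∧ f x < q.2} with hA
  have hAconv : Convex ℝ A := by
    rintro q ⟨x, hx, hxq, hxq'⟩ r ⟨y, hy, hyr, hyr'⟩ a b ha hb hab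
    have key : ∀ {s t s' t' : ℝ}, s < s' → t < t' → a * s + b * t < a * s' + b * t' := by
      intro s t s' t' h1 h2
      rcases ha.eq_or_lt with rfl | ha'
      · obtain rfl : b = 1 := by linarith
        linarith
      · nlinarith [mul_lt_mul_of_pos_left h1 ha', mul_le_mul_of_nonneg_left h2.le hb]
    refine ⟨a • x + b • y, hf.1 hx hy ha hb hab, fun j => ?_, ?_⟩
    · exact ((hh j).2 hx hy ha hb hab).trans_lt (key (hxq j) (hyr j))
    · exact (hf.2 hx hy ha hb hab).trans_lt (key hxq' hyr')
  have hAopen : IsOpen A := by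
    have : A = ⋃ x ∈ C, (Set.pi Set.univ fun j => Set.Ioi (h j x)) ×ˢ Set.Ioi (f x) := by
      ext q
      simp only [hA, Set.mem_ofPred_eq, Set.mem_iUnion, Set.mem_prod, Set.mem_pi, Set.mem_univ,
        true_imp_iff, Set.mem_Ioi, exists_prop]
    rw [this]
    exact isOpen_biUnion fun x _ =>
      (isOpen_set_pi Set.finite_univ fun j _ => isOpen_Ioi).prod isOpen_Ioi
  have hnot : ((0 : J → ℝ), v) ∉ A := by
    rintro ⟨x, hx, hx1, hx2⟩
    exact absurd (hv x hx fun j => (hx1 j).le) (not_le.2 hx2)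
  obtain ⟨φ, hφ⟩ := geometric_hahn_banach_open_point hAconv hAopen hnot
  -- The separating functional is smaller on `A` than at `(0, v)`, so its negated coefficients are
  -- the candidate multipliers.
  set l : J → ℝ := fun j => -φ (Pi.single j 1, 0) with hl
  set m : ℝ := -φ (0, 1) with hm
  have hrep : ∀ u t, φ (u, t) = -(∑ j, l j * u j + m * t) := by
    intro u t
    have h1 : ((u, t) : (J → ℝ) × ℝ) =
        ∑ j, u j • ((Pi.single j (1 : ℝ), (0 : ℝ)) : (J → ℝ) × ℝ) + t • ((0 : J → ℝ), (1 : ℝ)) := by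
      ext j
      · simp [Prod.fst_sum, Finset.sum_apply, Pi.single_apply]
      · simp [Prod.snd_sum]
    rw [h1, map_add, map_sum]
    simp only [map_smul, smul_eq_mul, hl, hm, neg_mul, Finset.sum_neg_distrib, neg_add, neg_neg]
    congr 1
    · exact Finset.sum_congr rfl fun j _ => mul_comm _ _
    · ring
  have hmain : ∀ x ∈ C, ∀ k : J → ℝ, (∀ j, 0 < k j) → ∀ r : ℝ, 0 < r →
      m * v < ∑ j, l j * (h j x + k j) + m * (f x + r) := by
    intro x hx k hk r hr
    have := hφ (fun j => h j x + k j, f x + r)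
      ⟨x, hx, fun j => by simpa using hk j, by simpa using hr⟩
    rw [hrep, hrep] at this
    simp at this
    linarith
  have hl0 : ∀ j, 0 ≤ l j := by
    intro i
    by_contra! hi
    -- If `l i` were negative, raising the slack in coordinate `i` by `|B| / (-l i)` would lower the
    -- separated quantity by `|B|`, violating `hmain`.
    set B : ℝ := ∑ j, l j * (h j x₀ + 1) + m * (f x₀ + 1) - m * v with hB
    have h1 := hmain x₀ hx₀ (fun j => 1 + if j = i then |B| / (-l i) else 0) (fun j => by
      split_ifs <;> [exact add_pos_of_pos_of_nonneg one_pos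
        (div_nonneg (abs_nonneg _) (by linarith)); simp]) 1 one_pos
    have h2 : ∑ j, l j * (h j x₀ + (1 + if j = i then |B| / (-l i) else 0)) =
        ∑ j, l j * (h j x₀ + 1) - |B| := by
      simp_rw [← add_assoc, mul_add (l _) (h _ x₀ + 1), Finset.sum_add_distrib, mul_ite, mul_zero]
      rw [Finset.sum_ite_eq' Finset.univ i, if_pos (Finset.mem_univ i)]
      have := hi.ne
      rw [mul_div_assoc', div_neg, mul_div_cancel_left₀ _ this, ← sub_eq_add_neg]
    rw [h2] at h1
    linarith [le_abs_self B]
  have hm0 : 0 ≤ m := by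
    by_contra! hi
    set B : ℝ := ∑ j, l j * (h j x₀ + 1) + m * (f x₀ + 1) - m * v with hB
    have h1 := hmain x₀ hx₀ (fun _ => 1) (fun _ => one_pos) (1 + |B| / (-m))
      (add_pos_of_pos_of_nonneg one_pos (div_nonneg (abs_nonneg _) (by linarith)))
    have h2 : m * (f x₀ + (1 + |B| / (-m))) = m * (f x₀ + 1) - |B| := by
      rw [← add_assoc, mul_add _ (f x₀ + 1), mul_div_assoc', div_neg,
        mul_div_cancel_left₀ _ hi.ne, ← sub_eq_add_neg]
    rw [h2] at h1
    linarith [le_abs_self B]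
  have hmpos : 0 < m := by
    -- Slater's condition enters here: if `m = 0`, the positive slacks `-h j x₀` reduce `hmain` to
    -- `0 < 0`.
    refine hm0.lt_of_ne fun h0 => ?_
    have h1 := hmain x₀ hx₀ (fun j => -h j x₀) (fun j => by linarith [hs j]) 1 one_pos
    rw [← h0] at h1
    simp at h1
  refine ⟨fun j => l j / m, fun j => div_nonneg (hl0 j) hm0, fun x hx => ?_⟩
  have hlim : m * v ≤ ∑ j, l j * h j x + m * f x := by
    refine le_of_forall_pos_le_add fun ε hε => ?_
    -- `D` is the total weight of the slacks, so slacks of size `ε / D` cost exactly `ε`.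
    set D : ℝ := ∑ j, l j + m with hD
    have hDpos : 0 < D := add_pos_of_nonneg_of_pos (Finset.sum_nonneg fun j _ => hl0 j) hmpos
    have h1 := hmain x hx (fun _ => ε / D) (fun _ => by positivity) (ε / D) (by positivity)
    simp_rw [mul_add, Finset.sum_add_distrib, ← Finset.sum_mul] at h1
    have h2 : (∑ j, l j) * (ε / D) + m * (ε / D) = ε := by
      rw [← add_mul, ← hD]
      field_simp
    linarith
  have : ∑ j, l j / m * h j x = (∑ j, l j * h j x) / m := by
    rw [Finset.sum_div]
    exact Finset.sum_congr rfl fun j _ => by ring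
  rw [this, ← sub_le_iff_le_add', le_div_iff₀ hmpos]
  linarith

/-! ### Closed convex functions on the nonnegative orthant: attainment and growth -/

namespace ClosedProperConvex

variable {ι : Type*} {U : (ι → ℝ) → EReal}

theorem coe_toReal (hU : ClosedProperConvex U) {ξ : ι → ℝ} (h : U ξ ≠ ⊤) :
    ((U ξ).toReal : EReal) = U ξ :=
  EReal.coe_toReal h (hU.ne_bot ξ)

/-- A closed proper convex function is convex as a real function on the nonnegative part of its
effective domain. -/
theorem convexOn_toReal (hU : ClosedProperConvex U) :
    ConvexOn ℝ {ξ | (∀ i, 0 ≤ ξ i) ∧ U ξ ≠ ⊤} (fun ξ => (U ξ).toReal) := by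
  have key : ∀ ξ η : ι → ℝ, U ξ ≠ ⊤ → U η ≠ ⊤ → ∀ a b : ℝ, 0 ≤ a → 0 ≤ b → a + b = 1 →
      U (a • ξ + b • η) ≤ ((a * (U ξ).toReal + b * (U η).toReal : ℝ) : EReal) := by
    intro ξ η hξ hη a b ha hb hab
    exact hU.convex_epigraph (x := (ξ, (U ξ).toReal)) (y := (η, (U η).toReal))
      (by simp [hU.coe_toReal hξ]) (by simp [hU.coe_toReal hη]) ha hb hab
  refine ⟨?_, ?_⟩
  · rintro ξ ⟨hξ0, hξ⟩ η ⟨hη0, hη⟩ a b ha hb hab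
    refine ⟨fun i => ?_, ne_top_of_le_ne_top (EReal.coe_ne_top _) (key ξ η hξ hη a b ha hb hab)⟩
    have h1 := mul_nonneg ha (hξ0 i)
    have h2 := mul_nonneg hb (hη0 i)
    simpa using add_nonneg h1 h2
  · rintro ξ ⟨hξ0, hξ⟩ η ⟨hη0, hη⟩ a b ha hb hab
    have h := key ξ η hξ hη a b ha hb hab
    rw [← hU.coe_toReal (ne_top_of_le_ne_top (EReal.coe_ne_top _) h)] at h
    exact_mod_cast h

/-- If the sublevel sets of `U` on the nonnegative orthant are bounded, then `U` attains its
minimum on every nonempty closed subset of the nonnegative part of its effective domain. -/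
theorem exists_isMinOn [Fintype ι] (hU : ClosedProperConvex U)
    (hc : ∀ c : ℝ, Bornology.IsBounded {ξ : ι → ℝ | (∀ i, 0 ≤ ξ i) ∧ U ξ ≤ (c : EReal)})
    {S : Set (ι → ℝ)} (hS : IsClosed S) (hS0 : ∀ ξ ∈ S, ∀ i, 0 ≤ ξ i) {ξ₀ : ι → ℝ}
    (hξ₀ : ξ₀ ∈ S) (hfin : U ξ₀ ≠ ⊤) :
    ∃ ξ ∈ S, U ξ ≠ ⊤ ∧ ∀ η ∈ S, U ξ ≤ U η := by
  set K : Set (ι → ℝ) := S ∩ U ⁻¹' Set.Iic (U ξ₀) with hK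
  have hKc : IsCompact K := by
    refine Metric.isCompact_of_isClosed_isBounded (hS.inter (hU.closed.isClosed_preimage _)) ?_
    refine (hc (U ξ₀).toReal).subset fun ξ hξ => ⟨hS0 ξ hξ.1, ?_⟩
    rw [hU.coe_toReal hfin]
    exact hξ.2
  have hKne : K.Nonempty := ⟨ξ₀, hξ₀, le_refl (U ξ₀)⟩
  obtain ⟨ξ, hξK, hξ⟩ := (hU.closed.lowerSemicontinuousOn K).exists_isMinOn hKne hKc
  have h0 : U ξ ≤ U ξ₀ := hξK.2
  refine ⟨ξ, hξK.1, ne_top_of_le_ne_top hfin h0, fun η hη => ?_⟩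
  by_cases h : U η ≤ U ξ₀
  · exact hξ ⟨hη, h⟩
  · exact h0.trans (not_le.1 h).le

/-- A closed proper convex function whose sublevel sets on the nonnegative orthant are bounded
grows at least linearly there. -/
theorem exists_linear_growth [Fintype ι] (hU : ClosedProperConvex U)
    (hc : ∀ c : ℝ, Bornology.IsBounded {ξ : ι → ℝ | (∀ i, 0 ≤ ξ i) ∧ U ξ ≤ (c : EReal)})
    {ξ₀ : ι → ℝ} (hξ₀ : ∀ i, 0 ≤ ξ₀ i) (hfin : U ξ₀ ≠ ⊤) :
    ∃ ε > 0, ∃ b : ℝ, ∀ ξ : ι → ℝ, (∀ i, 0 ≤ ξ i) → U ξ ≠ ⊤ → ε * ‖ξ‖ - b ≤ (U ξ).toReal := by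
  obtain ⟨R₀, hR₀⟩ := ((hc ((U ξ₀).toReal + 1)).subset_closedBall ξ₀)
  -- The added `1` puts points at distance `R` from `ξ₀` strictly outside the ball of radius `R₀`.
  set R : ℝ := max R₀ 0 + 1 with hR
  have hRpos : 0 < R := by positivity
  have hfar : ∀ ξ : ι → ℝ, (∀ i, 0 ≤ ξ i) → U ξ ≠ ⊤ → R ≤ ‖ξ - ξ₀‖ →
      (U ξ₀).toReal + 1 < (U ξ).toReal := by
    intro ξ h0 hξ hn
    by_contra! hle
    have : ξ ∈ Metric.closedBall ξ₀ R₀ := hR₀ ⟨h0, by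
      rw [← hU.coe_toReal hξ]
      exact_mod_cast hle⟩
    rw [Metric.mem_closedBall, dist_eq_norm] at this
    linarith [le_max_left R₀ 0]
  obtain ⟨η, hη0, hηfin, hη⟩ := hU.exists_isMinOn hc (S := {ξ | ∀ i, 0 ≤ ξ i})
    (by
      simp only [Set.ofPred_forall]
      exact isClosed_iInter fun i => isClosed_le continuous_const (continuous_apply i))
    (fun ξ h => h) hξ₀ hfin
  have hmin : ∀ ξ : ι → ℝ, (∀ i, 0 ≤ ξ i) → U ξ ≠ ⊤ → (U η).toReal ≤ (U ξ).toReal :=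
    fun ξ h0 hξ => EReal.toReal_le_toReal (hη ξ h0) (hU.ne_bot η) hξ
  refine ⟨R⁻¹, by positivity, R⁻¹ * ‖ξ₀‖ + 1 + |(U η).toReal| , fun ξ h0 hξ => ?_⟩
  have htri : ‖ξ‖ ≤ ‖ξ - ξ₀‖ + ‖ξ₀‖ := by simpa using norm_add_le (ξ - ξ₀) ξ₀
  have h1 : R⁻¹ * ‖ξ‖ ≤ R⁻¹ * ‖ξ - ξ₀‖ + R⁻¹ * ‖ξ₀‖ := by
    rw [← mul_add]
    gcongr
  have habs := neg_abs_le (U η).toReal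
  rcases le_or_gt R ‖ξ - ξ₀‖ with hn | hn
  · have hd : 0 < ‖ξ - ξ₀‖ := hRpos.trans_le hn
    -- The point at parameter `t` on the segment from `ξ₀` to `ξ` has distance `R` from `ξ₀`. There
    -- `U` has risen by more than `1`, so convexity forces a slope of at least `1 / R` beyond it.
    set t : ℝ := R / ‖ξ - ξ₀‖ with ht
    have ht0 : 0 < t := by positivity
    have ht1 : t ≤ 1 := (div_le_one hd).2 hn
    have hmem := hU.convexOn_toReal.1 (x := ξ₀) (y := ξ) ⟨hξ₀, hfin⟩ ⟨h0, hξ⟩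
      (sub_nonneg.2 ht1) ht0.le (by ring)
    have hle := hU.convexOn_toReal.2 (x := ξ₀) (y := ξ) ⟨hξ₀, hfin⟩ ⟨h0, hξ⟩
      (sub_nonneg.2 ht1) ht0.le (by ring)
    have hdist : (1 - t) • ξ₀ + t • ξ - ξ₀ = t • (ξ - ξ₀) := by
      rw [sub_smul, smul_sub, one_smul]
      abel
    have hgt := hfar _ hmem.1 hmem.2 (by
      rw [hdist, norm_smul, Real.norm_of_nonneg ht0.le, ht, div_mul_cancel₀ _ hd.ne'])
    simp only [smul_eq_mul] at hle
    have h2 : 1 < t * ((U ξ).toReal - (U ξ₀).toReal) := by linarith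
    have h3 : R⁻¹ * ‖ξ - ξ₀‖ = t⁻¹ := by
      rw [ht, inv_div, div_eq_inv_mul]
    have h4 : t⁻¹ < (U ξ).toReal - (U ξ₀).toReal := by
      rwa [inv_lt_iff_one_lt_mul₀ ht0, mul_comm]
    have := hmin ξ₀ hξ₀ hfin
    linarith
  · have h2 : R⁻¹ * ‖ξ - ξ₀‖ ≤ 1 := by
      rw [inv_mul_le_iff₀ hRpos]
      linarith
    have := hmin ξ h0 hξ
    linarith

end ClosedProperConvex

/-! ### Relative entropy, truncated densities and differentiation of exponential integrals -/

section Measure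

variable {W : Type*} [MeasurableSpace W] {μ : Measure W}

/-- The Kullback-Leibler divergence from a tilted measure, in terms of the one from the original
measure. -/
theorem klDiv_tilted_right [IsProbabilityMeasure μ] {p : Measure W} [IsProbabilityMeasure p]
    {f : W → ℝ} (hkl : InformationTheory.klDiv p μ ≠ ⊤) (hf : Integrable f p)
    (hexp : Integrable (fun w => Real.exp (f w)) μ) :
    InformationTheory.klDiv p (μ.tilted f) ≠ ⊤ ∧
    (InformationTheory.klDiv p (μ.tilted f)).toReal =
      (InformationTheory.klDiv p μ).toReal - ∫ w, f w ∂p + Real.log (∫ w, Real.exp (f w) ∂μ) := by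
  obtain ⟨hac, hint⟩ := InformationTheory.klDiv_ne_top_iff.1 hkl
  have := isProbabilityMeasure_tilted hexp
  have hac' : p ≪ μ.tilted f := hac.trans (absolutelyContinuous_tilted hexp)
  refine ⟨InformationTheory.klDiv_ne_top hac' (integrable_llr_tilted_right hac hf hint hexp), ?_⟩
  rw [InformationTheory.toReal_klDiv_of_measure_eq hac' (by simp),
    InformationTheory.toReal_klDiv_of_measure_eq hac (by simp),
    integral_llr_tilted_right hac hf hexp hint]

/-- The Kullback-Leibler divergence of a tilted measure from the original measure. -/
theorem klDiv_tilted_left [IsProbabilityMeasure μ] {f : W → ℝ}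
    (hexp : Integrable (fun w => Real.exp (f w)) μ) (hf : Integrable f (μ.tilted f)) :
    InformationTheory.klDiv (μ.tilted f) μ ≠ ⊤ ∧
    (InformationTheory.klDiv (μ.tilted f) μ).toReal =
      ∫ w, f w ∂(μ.tilted f) - Real.log (∫ w, Real.exp (f w) ∂μ) := by
  have := isProbabilityMeasure_tilted hexp
  have hac : μ.tilted f ≪ μ := tilted_absolutelyContinuous μ f
  have hfm : AEMeasurable f μ := Real.aemeasurable_of_aemeasurable_exp hexp.1.aemeasurable
  have hllr : llr (μ.tilted f) μ =ᵐ[μ.tilted f]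
      fun w => f w - Real.log (∫ w, Real.exp (f w) ∂μ) := by
    filter_upwards [hac (llr_tilted_left Measure.AbsolutelyContinuous.rfl hexp hfm),
      hac (llr_self μ)] with w h1 h2
    rw [h1, h2]
    simp
  have hint : Integrable (llr (μ.tilted f) μ) (μ.tilted f) := by
    rw [integrable_congr hllr]
    exact hf.sub (integrable_const _)
  refine ⟨InformationTheory.klDiv_ne_top hac hint, ?_⟩
  rw [InformationTheory.toReal_klDiv_of_measure_eq hac (by simp), integral_congr_ae hllr,
    integral_sub hf (integrable_const _)]
  simp

/-- With the value `0` at `0`, `x log x` is continuous on the compact interval `[0, B]`. -/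
theorem exists_abs_mul_log_le (B : ℝ) :
    ∃ D, ∀ x : ℝ, 0 ≤ x → x ≤ B → |x * Real.log x| ≤ D := by
  obtain ⟨D, hD⟩ := (isCompact_Icc (a := (0 : ℝ)) (b := B)).exists_bound_of_continuousOn
    Real.continuous_mul_log.continuousOn
  exact ⟨D, fun x h0 hB => hD x ⟨h0, hB⟩⟩

/-- The Kullback-Leibler divergence of a measure with a bounded density. -/
theorem klDiv_withDensity_of_bounded [IsProbabilityMeasure μ] {ρ : W → ℝ} (hρ : Measurable ρ)
    (h0 : ∀ w, 0 ≤ ρ w) {B : ℝ} (hB : ∀ w, ρ w ≤ B) (h1 : ∫ w, ρ w ∂μ = 1) :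
    InformationTheory.klDiv (μ.withDensity fun w => ENNReal.ofReal (ρ w)) μ =
      ENNReal.ofReal (∫ w, ρ w * Real.log (ρ w) ∂μ) := by
  obtain ⟨D, hD⟩ := exists_abs_mul_log_le B
  have hint : Integrable ρ μ := .of_integral_ne_zero (by simp [h1])
  have hlog : Integrable (fun w => ρ w * Real.log (ρ w)) μ :=
    Integrable.of_bound (by fun_prop) D (ae_of_all _ fun w => hD _ (h0 w) (hB w))
  have : IsFiniteMeasure (μ.withDensity fun w => ENNReal.ofReal (ρ w)) :=
    isFiniteMeasure_withDensity_ofReal hint.2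
  -- The affine correction `1 - ρ` integrates to zero against a probability measure, leaving only
  -- the entropy.
  have hkl : ∀ w, InformationTheory.klFun (ρ w) = ρ w * Real.log (ρ w) + (1 - ρ w) := by
    intro w
    rw [InformationTheory.klFun]
    ring
  have hlin : Integrable (fun w => 1 - ρ w) μ := (integrable_const _).sub hint
  rw [InformationTheory.klDiv_eq_lintegral_klFun_of_ac (withDensity_absolutelyContinuous _ _)]
  have hrn := Measure.rnDeriv_withDensity μ (f := fun w => ENNReal.ofReal (ρ w)) (by fun_prop)
  calc ∫⁻ w, ENNReal.ofReal (InformationTheory.klFun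
        ((μ.withDensity fun w => ENNReal.ofReal (ρ w)).rnDeriv μ w).toReal) ∂μ
      = ∫⁻ w, ENNReal.ofReal (InformationTheory.klFun (ρ w)) ∂μ := by
        refine lintegral_congr_ae ?_
        filter_upwards [hrn] with w hw
        rw [hw, ENNReal.toReal_ofReal (h0 w)]
    _ = ENNReal.ofReal (∫ w, InformationTheory.klFun (ρ w) ∂μ) := by
        rw [ofReal_integral_eq_lintegral_ofReal]
        · simp_rw [hkl]
          exact hlog.add hlin
        · exact ae_of_all _ fun w => InformationTheory.klFun_nonneg (h0 w)
    _ = _ := by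
        simp_rw [hkl]
        rw [integral_add hlog hlin, integral_sub (integrable_const _) hint, h1]
        simp

/-- The bounded probability densities that vanish where one of the functions `g j` is large. -/
def truncatedDensities {J : Type*} (μ : Measure W) (g : J → W → ℝ) : Set (W → ℝ) :=
  {ρ | Measurable ρ ∧ (∀ w, 0 ≤ ρ w) ∧ ∫ w, ρ w ∂μ = 1 ∧
    ∃ B, ∀ w, ρ w ≤ B ∧ (ρ w ≠ 0 → ∀ j, |g j w| ≤ B)}

section Densities

variable {J : Type*} {g : J → W → ℝ} {ρ : W → ℝ}

theorem integrable_truncatedDensity (hρ : ρ ∈ truncatedDensities μ g) : Integrable ρ μ :=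
  .of_integral_ne_zero (by simp [hρ.2.2.1])

theorem integrable_mul_log_truncatedDensity [IsFiniteMeasure μ]
    (hρ : ρ ∈ truncatedDensities μ g) : Integrable (fun w => ρ w * Real.log (ρ w)) μ := by
  obtain ⟨hm, h0, h1, B, hB⟩ := hρ
  obtain ⟨D, hD⟩ := exists_abs_mul_log_le B
  exact Integrable.of_bound (by fun_prop) D (ae_of_all _ fun w => hD _ (h0 w) (hB w).1)

theorem integrable_mul_truncatedDensity [IsFiniteMeasure μ] (hg : ∀ j, Measurable (g j))
    (hρ : ρ ∈ truncatedDensities μ g) (j : J) : Integrable (fun w => ρ w * g j w) μ := by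
  obtain ⟨hm, h0, h1, B, hB⟩ := hρ
  have := hg j
  refine Integrable.of_bound (by fun_prop) (B * B) (ae_of_all _ fun w => ?_)
  rw [Real.norm_eq_abs, abs_mul, abs_of_nonneg (h0 w)]
  by_cases hw : ρ w = 0
  · rw [hw, zero_mul]
    exact mul_self_nonneg B
  · exact mul_le_mul (hB w).1 ((hB w).2 hw j) (abs_nonneg _) ((h0 w).trans (hB w).1)

theorem convex_truncatedDensities : Convex ℝ (truncatedDensities μ g) := by
  rintro ρ hρ σ hσ a b ha hb hab
  have hρi := integrable_truncatedDensity hρ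
  have hσi := integrable_truncatedDensity hσ
  obtain ⟨hm, h0, h1, B, hB⟩ := hρ
  obtain ⟨hm', h0', h1', B', hB'⟩ := hσ
  refine ⟨(hm.const_smul a).add (hm'.const_smul b), fun w => ?_, ?_, max B B', fun w => ⟨?_, ?_⟩⟩
  · exact add_nonneg (mul_nonneg ha (h0 w)) (mul_nonneg hb (h0' w))
  · simp only [Pi.add_apply, Pi.smul_apply, smul_eq_mul]
    rw [integral_add (hρi.const_mul a) (hσi.const_mul b), integral_const_mul, integral_const_mul,
      h1, h1']
    linarith
  · calc a * ρ w + b * σ w ≤ a * max B B' + b * max B B' := by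
          gcongr
          · exact (hB w).1.trans (le_max_left _ _)
          · exact (hB' w).1.trans (le_max_right _ _)
      _ = max B B' := by rw [← add_mul, hab, one_mul]
  · intro hw j
    by_cases h : ρ w = 0
    · have : σ w ≠ 0 := fun h' => hw (by simp [h, h'])
      exact ((hB' w).2 this j).trans (le_max_right _ _)
    · exact ((hB w).2 h j).trans (le_max_left _ _)

theorem convexOn_integral_mul_log [IsFiniteMeasure μ] :
    ConvexOn ℝ (truncatedDensities μ g) (fun ρ => ∫ w, ρ w * Real.log (ρ w) ∂μ) := by
  refine ⟨convex_truncatedDensities, fun ρ hρ σ hσ a b ha hb hab => ?_⟩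
  have h := integral_mono
    (integrable_mul_log_truncatedDensity (convex_truncatedDensities hρ hσ ha hb hab))
    (((integrable_mul_log_truncatedDensity hρ).const_mul a).add ((integrable_mul_log_truncatedDensity hσ).const_mul b))
    fun w => Real.convexOn_mul_log.2 (hρ.2.1 w) (hσ.2.1 w) ha hb hab
  simp only [Pi.add_apply] at h
  rw [integral_add ((integrable_mul_log_truncatedDensity hρ).const_mul a) ((integrable_mul_log_truncatedDensity hσ).const_mul b),
    integral_const_mul, integral_const_mul] at h
  exact h

theorem integral_mul_of_convexCombination [IsFiniteMeasure μ] (hg : ∀ j, Measurable (g j))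
    {σ : W → ℝ} (hρ : ρ ∈ truncatedDensities μ g) (hσ : σ ∈ truncatedDensities μ g) (a b : ℝ)
    (j : J) :
    ∫ w, (a • ρ + b • σ) w * g j w ∂μ = a * ∫ w, ρ w * g j w ∂μ + b * ∫ w, σ w * g j w ∂μ := by
  rw [← integral_const_mul, ← integral_const_mul,
    ← integral_add ((integrable_mul_truncatedDensity hg hρ j).const_mul a) ((integrable_mul_truncatedDensity hg hσ j).const_mul b)]
  congr 1
  ext w
  simp only [Pi.add_apply, Pi.smul_apply, smul_eq_mul]
  ring

/-- The density proportional to `exp f` on the set where all `g j` are bounded by `n`, its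
normalization factor and its entropy. -/
theorem exists_truncatedDensity [Fintype J] [IsProbabilityMeasure μ] (hg : ∀ j, Measurable (g j))
    (α : J → ℝ) (n : ℕ)
    (hn : μ {w | ∀ j, |g j w| ≤ n} ≠ 0) :
    ∃ ρ ∈ truncatedDensities μ g,
      0 < ∫ w in {w | ∀ j, |g j w| ≤ n}, Real.exp (∑ j, α j * g j w) ∂μ ∧
      ENNReal.ofReal (∫ w in {w | ∀ j, |g j w| ≤ n}, Real.exp (∑ j, α j * g j w) ∂μ) =
        ∫⁻ w in {w | ∀ j, |g j w| ≤ n}, ENNReal.ofReal (Real.exp (∑ j, α j * g j w)) ∂μ ∧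
      ∫ w, ρ w * Real.log (ρ w) ∂μ = ∑ j, α j * ∫ w, ρ w * g j w ∂μ
        - Real.log (∫ w in {w | ∀ j, |g j w| ≤ n}, Real.exp (∑ j, α j * g j w) ∂μ) := by
  set S : Set W := {w | ∀ j, |g j w| ≤ n} with hS
  set f : W → ℝ := fun w => ∑ j, α j * g j w with hf
  set z : ℝ := ∫ w in S, Real.exp (f w) ∂μ with hz
  have hSm : MeasurableSet S := by
    rw [hS, Set.ofPred_forall]
    exact MeasurableSet.iInter fun j => measurableSet_le (hg j).abs measurable_const
  have hfm : Measurable f := by fun_prop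
  set D : ℝ := ∑ j, |α j| * n with hD
  have hfS : ∀ w ∈ S, |f w| ≤ D := fun w hw =>
    (Finset.abs_sum_le_sum_abs _ _).trans (Finset.sum_le_sum fun j _ => by
      rw [abs_mul]
      exact mul_le_mul_of_nonneg_left (hw j) (abs_nonneg _))
  have hexpint : IntegrableOn (fun w => Real.exp (f w)) S μ := by
    refine Integrable.of_bound (by fun_prop) (Real.exp D) ?_
    filter_upwards [ae_restrict_mem hSm] with w hw
    rw [Real.norm_of_nonneg (Real.exp_pos _).le]
    exact Real.exp_le_exp.2 ((le_abs_self _).trans (hfS w hw))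
  have hzpos : 0 < z := by
    rw [hz, setIntegral_pos_iff_support_of_nonneg_ae (ae_of_all _ fun w => (Real.exp_pos _).le)
      hexpint]
    have : Function.support (fun w => Real.exp (f w)) = Set.univ := by
      ext w
      simp [(Real.exp_pos _).ne']
    rw [this, Set.univ_inter]
    exact pos_iff_ne_zero.2 hn
  set ρ : W → ℝ := S.indicator fun w => Real.exp (f w) / z with hρ
  have hρS : ∀ w ∈ S, ρ w = Real.exp (f w) / z := fun w hw => Set.indicator_of_mem hw _
  have hρS' : ∀ w, w ∉ S → ρ w = 0 := fun w hw => Set.indicator_of_notMem hw _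
  have hmem : ρ ∈ truncatedDensities μ g := by
    refine ⟨(by fun_prop : Measurable fun w => Real.exp (f w) / z).indicator hSm, fun w => ?_, ?_,
      max (Real.exp D / z) n, fun w => ⟨?_, fun hw j => ?_⟩⟩
    · exact Set.indicator_nonneg (fun w _ => by positivity) w
    · rw [hρ, integral_indicator hSm, integral_div, ← hz, div_self hzpos.ne']
    · by_cases hw : w ∈ S
      · rw [hρS w hw]
        refine le_max_of_le_left (div_le_div_of_nonneg_right ?_ hzpos.le)
        exact Real.exp_le_exp.2 ((le_abs_self _).trans (hfS w hw))
      · rw [hρS' w hw]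
        positivity
    · by_cases h : w ∈ S
      · exact (h j).trans (le_max_right _ _)
      · exact absurd (hρS' w h) hw
  refine ⟨ρ, hmem, hzpos, ?_, ?_⟩
  · rw [hz, ofReal_integral_eq_lintegral_ofReal hexpint (ae_of_all _ fun w => (Real.exp_pos _).le)]
  -- On `S`, `log ρ = f - log z`; off `S`, both sides vanish because `0 * log 0 = 0`.
  · have hpt : ∀ w, ρ w * Real.log (ρ w) = ∑ j, α j * (ρ w * g j w) - Real.log z * ρ w := by
      intro w
      by_cases hw : w ∈ S
      · have h1 : Real.log (ρ w) = f w - Real.log z := by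
          rw [hρS w hw, Real.log_div (Real.exp_pos _).ne' hzpos.ne', Real.log_exp]
        rw [h1, mul_sub, hf, Finset.mul_sum, mul_comm (Real.log z)]
        congr 1
        exact Finset.sum_congr rfl fun j _ => by ring
      · simp [hρS' w hw]
    simp_rw [hpt]
    have hi : ∀ j ∈ Finset.univ, Integrable (fun w => α j * (ρ w * g j w)) μ :=
      fun j _ => (integrable_mul_truncatedDensity hg hmem j).const_mul _
    rw [integral_sub (integrable_finsetSum _ hi) ((integrable_truncatedDensity hmem).const_mul _),
      integral_finsetSum _ hi, integral_const_mul, hmem.2.2.1, mul_one]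
    simp_rw [integral_const_mul]

/-- As `J` is finite, the truncation sets increase to the whole space, and continuity from below of
the measure with density `F` gives the bound in the limit. -/
theorem lintegral_le_of_forall_truncation [Fintype J] (hg : ∀ j, Measurable (g j))
    {F : W → ℝ≥0∞} {c : ℝ≥0∞} {n₀ : ℕ}
    (h : ∀ n : ℕ, n₀ ≤ n → ∫⁻ w in {w | ∀ j, |g j w| ≤ n}, F w ∂μ ≤ c) :
    ∫⁻ w, F w ∂μ ≤ c := by
  have hSm : ∀ n : ℕ, MeasurableSet {w | ∀ j, |g j w| ≤ n} := fun n => by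
    rw [Set.ofPred_forall]
    exact MeasurableSet.iInter fun j => measurableSet_le (hg j).abs measurable_const
  have hmono : Monotone fun n : ℕ => {w | ∀ j, |g j w| ≤ n} := fun m n hmn w hw j =>
    (hw j).trans (by exact_mod_cast hmn)
  have hunion : ⋃ n : ℕ, {w | ∀ j, |g j w| ≤ n} = Set.univ := by
    refine Set.eq_univ_of_forall fun w => Set.mem_iUnion.2 ?_
    obtain ⟨n, hn⟩ := exists_nat_ge (∑ j, |g j w|)
    exact ⟨n, fun j => (Finset.single_le_sum (f := fun j => |g j w|)
      (fun j _ => abs_nonneg _) (Finset.mem_univ j)).trans hn⟩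
  have hlim := tendsto_measure_iUnion_atTop (μ := μ.withDensity F) hmono
  rw [hunion, withDensity_apply _ MeasurableSet.univ, setLIntegral_univ] at hlim
  refine le_of_tendsto hlim ?_
  filter_upwards [Filter.eventually_ge_atTop n₀] with n hn
  simpa [withDensity_apply _ (hSm n)] using h n hn

theorem exists_truncation_ne_zero [Fintype J] [IsProbabilityMeasure μ]
    (hg : ∀ j, Measurable (g j)) :
    ∃ n₀ : ℕ, ∀ n : ℕ, n₀ ≤ n → μ {w | ∀ j, |g j w| ≤ n} ≠ 0 := by
  by_contra! hcon
  have hmono : Monotone fun n : ℕ => {w | ∀ j, |g j w| ≤ n} := fun m n hmn w hw j =>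
    (hw j).trans (by exact_mod_cast hmn)
  have hzero : ∀ n : ℕ, μ {w | ∀ j, |g j w| ≤ n} = 0 := fun n => by
    obtain ⟨m, hm, h0⟩ := hcon n
    exact measure_mono_null (hmono hm) h0
  have := lintegral_le_of_forall_truncation (μ := μ) hg (F := fun _ => 1) (c := 0)
    (n₀ := 0) (fun n _ => by simp [hzero n])
  simp at this

end Densities

/-- If `∫ exp (s d)` is at least `1 - s K` for all small `s > 0`, then `d` is integrable
and its integral is at least `-K`. -/
theorem integrable_of_le_integral_exp {ν : Measure W} [IsProbabilityMeasure ν] {d : W → ℝ}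
    (hd : Measurable d) {K s₀ : ℝ} (hs₀ : 0 < s₀)
    (hint : ∀ s, 0 < s → s ≤ s₀ → Integrable (fun w => Real.exp (s * d w)) ν)
    (hle : ∀ s, 0 < s → s ≤ s₀ → 1 - s * K ≤ ∫ w, Real.exp (s * d w) ∂ν) :
    Integrable d ν ∧ -K ≤ ∫ w, d w ∂ν := by
  -- These are the difference quotients of `s ↦ exp (s * d w)` at `0`. By convexity they are
  -- nondecreasing in `s`, and they tend to `d w` as `s` decreases to `0`.
  set e : ℝ → W → ℝ := fun s w => (Real.exp (s * d w) - 1) / s with he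
  have heint : ∀ s, 0 < s → s ≤ s₀ → Integrable (e s) ν := fun s h1 h2 =>
    ((hint s h1 h2).sub (integrable_const _)).div_const _
  have hele : ∀ s, 0 < s → s ≤ s₀ → -K ≤ ∫ w, e s w ∂ν := fun s h1 h2 => by
    rw [he, integral_div, integral_sub (hint s h1 h2) (integrable_const _), le_div_iff₀ h1]
    have := hle s h1 h2
    simp
    linarith
  have hmono : ∀ s, 0 < s → s ≤ s₀ → ∀ w, e s w ≤ e s₀ w := by
    intro s h1 h2 w
    have hcv := convexOn_exp.2 (Set.mem_univ 0) (Set.mem_univ (s₀ * d w))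
      (sub_nonneg.2 ((div_le_one hs₀).2 h2)) (div_nonneg h1.le hs₀.le) (by ring)
    have hs : (1 - s / s₀) • (0 : ℝ) + (s / s₀) • (s₀ * d w) = s * d w := by
      simp only [smul_eq_mul]
      field_simp
      ring
    rw [hs, Real.exp_zero] at hcv
    simp only [smul_eq_mul, mul_one] at hcv
    simp only [he]
    rw [div_le_iff₀ h1]
    have : (Real.exp (s₀ * d w) - 1) / s₀ * s = s / s₀ * Real.exp (s₀ * d w) - s / s₀ := by ring
    linarith
  set t : ℕ → ℝ := fun n => s₀ / (n + 1) with ht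
  have htpos : ∀ n, 0 < t n := fun n => by positivity
  have htle : ∀ n, t n ≤ s₀ := fun n => div_le_self hs₀.le (by linarith [n.cast_nonneg (α := ℝ)])
  have htlim : Filter.Tendsto t Filter.atTop (𝓝[≠] 0) := by
    refine tendsto_nhdsWithin_iff.2 ⟨?_, Filter.Eventually.of_forall fun n => (htpos n).ne'⟩
    simpa [ht, div_eq_mul_inv] using
      (tendsto_one_div_add_atTop_nhds_zero_nat (𝕜 := ℝ)).const_mul s₀
  have helim : ∀ w, Filter.Tendsto (fun n => e (t n) w) Filter.atTop (𝓝 (d w)) := by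
    intro w
    have h1 : HasDerivAt (fun s : ℝ => Real.exp (s * d w)) (d w) 0 := by
      simpa using ((hasDerivAt_id (0 : ℝ)).mul_const (d w)).exp
    have h2 := (hasDerivAt_iff_tendsto_slope_zero.1 h1).comp htlim
    refine h2.congr fun n => ?_
    simp [he, div_eq_inv_mul]
  have hbound : ∀ n, ∫⁻ w, ENNReal.ofReal (e s₀ w - e (t n) w) ∂ν ≤
      ENNReal.ofReal (∫ w, e s₀ w ∂ν + K) := by
    intro n
    have hi := (heint s₀ hs₀ le_rfl).sub (heint _ (htpos n) (htle n))
    have hnn : 0 ≤ᵐ[ν] fun w => e s₀ w - e (t n) w :=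
      ae_of_all _ fun w => sub_nonneg.2 (hmono _ (htpos n) (htle n) w)
    refine (ofReal_integral_eq_lintegral_ofReal hi hnn).symm.trans_le ?_
    simp only [Pi.sub_apply]
    rw [integral_sub (heint s₀ hs₀ le_rfl) (heint _ (htpos n) (htle n))]
    refine ENNReal.ofReal_le_ofReal ?_
    linarith [hele _ (htpos n) (htle n)]
  -- Fatou's lemma for the nonnegative functions `e s₀ - e (t n)` yields both the integrability of
  -- `d` and the lower bound on its integral.
  have hfatou : ∫⁻ w, ENNReal.ofReal (e s₀ w - d w) ∂ν ≤
      ENNReal.ofReal (∫ w, e s₀ w ∂ν + K) := by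
    have hlim : ∀ w, Filter.liminf (fun n => ENNReal.ofReal (e s₀ w - e (t n) w)) Filter.atTop =
        ENNReal.ofReal (e s₀ w - d w) := fun w =>
      ((ENNReal.continuous_ofReal.tendsto _).comp ((helim w).const_sub (e s₀ w))).liminf_eq
    simp_rw [← hlim]
    refine (lintegral_liminf_le fun n => by fun_prop).trans ?_
    exact Filter.liminf_le_of_le (by isBoundedDefault) fun b hb => by
      obtain ⟨n, hn⟩ := hb.exists
      exact hn.trans (hbound n)
  have hnn : 0 ≤ᵐ[ν] fun w => e s₀ w - d w := ae_of_all _ fun w => sub_nonneg.2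
    (le_of_tendsto' (helim w) fun n => hmono _ (htpos n) (htle n) w)
  have hdiff : Integrable (fun w => e s₀ w - d w) ν :=
    (lintegral_ofReal_ne_top_iff_integrable (by fun_prop) hnn).1
      (ne_top_of_le_ne_top ENNReal.ofReal_ne_top hfatou)
  have hdint : Integrable d ν :=
    ((heint s₀ hs₀ le_rfl).sub hdiff).congr (ae_of_all _ fun w => by simp)
  refine ⟨hdint, ?_⟩
  rw [← ofReal_integral_eq_lintegral_ofReal hdiff hnn,
    ENNReal.ofReal_le_ofReal_iff (by linarith [hele s₀ hs₀ le_rfl]),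
    integral_sub (heint s₀ hs₀ le_rfl) hdint] at hfatou
  linarith

end Measure

/-! ### Normalization factor, conjugate and weak duality -/

namespace MaxEnDNet

variable {X Y W : Type*} [MeasurableSpace W] (P : MaxEnDNet X Y W)

/-- The slack vectors at which the slack function is finite. -/
def slackDom : Set (Fin P.N → ℝ) :=
  {ξ | (∀ i, 0 ≤ ξ i) ∧ P.U ξ ≠ ⊤}

/-- The logarithm of the normalization factor, as a real number. -/
noncomputable def logZ (α : P.Idx → ℝ) : ℝ :=
  Real.log (∫ w, Real.exp (P.exponent α w) ∂P.prior)

variable {P}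

theorem measurable_gap (hF : ∀ x y, Measurable (P.F x y)) (j : P.Idx) : Measurable (P.gap j) :=
  ((hF _ _).sub (hF _ _)).sub_const _

theorem measurable_exponent (hF : ∀ x y, Measurable (P.F x y)) (α : P.Idx → ℝ) :
    Measurable (P.exponent α) := by
  have := measurable_gap hF
  unfold exponent
  fun_prop

theorem integrable_exponent {p : Measure W} (h : ∀ j, Integrable (P.gap j) p) (α : P.Idx → ℝ) :
    Integrable (P.exponent α) p :=
  integrable_finsetSum _ fun j _ => (h j).const_mul _

theorem integral_exponent {p : Measure W} (h : ∀ j, Integrable (P.gap j) p) (α : P.Idx → ℝ) :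
    ∫ w, P.exponent α w ∂p = ∑ j, α j * ∫ w, P.gap j w ∂p := by
  unfold exponent
  rw [integral_finsetSum _ fun j _ => (h j).const_mul _]
  simp_rw [integral_const_mul]

section Normalization

variable {α : P.Idx → ℝ}

theorem integrable_exp_exponent (hF : ∀ x y, Measurable (P.F x y)) (hZ : P.Z α ≠ ⊤) :
    Integrable (fun w => Real.exp (P.exponent α w)) P.prior := by
  have := measurable_exponent hF α
  exact (lintegral_ofReal_ne_top_iff_integrable (by fun_prop)
    (ae_of_all _ fun w => (Real.exp_pos _).le)).1 hZ

theorem integral_exp_exponent_pos (hprior : IsProbabilityMeasure P.prior)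
    (hF : ∀ x y, Measurable (P.F x y)) (hZ : P.Z α ≠ ⊤) :
    0 < ∫ w, Real.exp (P.exponent α w) ∂P.prior :=
  integral_exp_pos (integrable_exp_exponent hF hZ)

theorem Z_eq_ofReal (hF : ∀ x y, Measurable (P.F x y)) (hZ : P.Z α ≠ ⊤) :
    P.Z α = ENNReal.ofReal (∫ w, Real.exp (P.exponent α w) ∂P.prior) :=
  (ofReal_integral_eq_lintegral_ofReal (integrable_exp_exponent hF hZ)
    (ae_of_all _ fun _ => (Real.exp_pos _).le)).symm

theorem log_Z (hprior : IsProbabilityMeasure P.prior) (hF : ∀ x y, Measurable (P.F x y))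
    (hZ : P.Z α ≠ ⊤) : (P.Z α).log = (P.logZ α : EReal) := by
  rw [Z_eq_ofReal hF hZ, ENNReal.log_ofReal_of_pos (integral_exp_exponent_pos hprior hF hZ), logZ]

theorem gibbs_eq_tilted (hprior : IsProbabilityMeasure P.prior)
    (hF : ∀ x y, Measurable (P.F x y)) (hZ : P.Z α ≠ ⊤) :
    P.gibbs α = P.prior.tilted (P.exponent α) := by
  have hpos := integral_exp_exponent_pos hprior hF hZ
  rw [gibbs, Measure.tilted]
  congr 1
  ext w
  rw [Z_eq_ofReal hF hZ, ← ENNReal.ofReal_inv_of_pos hpos, ← ENNReal.ofReal_mul (by positivity),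
    div_eq_inv_mul]

end Normalization

section Conjugate

theorem conjU_le_coe_iff (hU : ClosedProperConvex P.U) {α : P.Idx → ℝ} {r : ℝ} :
    P.conjU α ≤ (r : EReal) ↔
      ∀ ξ ∈ P.slackDom, ∑ j : P.Idx, α j * ξ j.1 - (P.U ξ).toReal ≤ r := by
  rw [conjU, iSup₂_le_iff]
  constructor
  · rintro h ξ ⟨h0, hξ⟩
    have := h ξ h0
    rw [← hU.coe_toReal hξ] at this
    exact_mod_cast this
  · intro h ξ h0
    by_cases hξ : P.U ξ = ⊤
    · simp [hξ]
    · rw [← hU.coe_toReal hξ]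
      exact_mod_cast h ξ ⟨h0, hξ⟩

theorem slackDom_nonempty (hdom : ∀ M : ℝ, ∃ ξ : Fin P.N → ℝ, (∀ i, M ≤ ξ i) ∧ P.U ξ ≠ ⊤) :
    P.slackDom.Nonempty :=
  hdom 0

theorem conjU_ne_bot (hU : ClosedProperConvex P.U) (hne : P.slackDom.Nonempty)
    (α : P.Idx → ℝ) : P.conjU α ≠ ⊥ := by
  obtain ⟨ξ, h0, hξ⟩ := hne
  have h : (((∑ j : P.Idx, α j * ξ j.1 : ℝ) : EReal) - P.U ξ) ≤ P.conjU α :=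
    le_iSup₂_of_le ξ h0 le_rfl
  rw [← hU.coe_toReal hξ, ← EReal.coe_sub] at h
  exact ne_bot_of_le_ne_bot (EReal.coe_ne_bot _) h

theorem le_toReal_conjU (hU : ClosedProperConvex P.U) (hne : P.slackDom.Nonempty)
    {α : P.Idx → ℝ} (h : P.conjU α ≠ ⊤) {ξ : Fin P.N → ℝ} (hξ : ξ ∈ P.slackDom) :
    ∑ j : P.Idx, α j * ξ j.1 - (P.U ξ).toReal ≤ (P.conjU α).toReal :=
  (conjU_le_coe_iff hU).1 (EReal.coe_toReal h (conjU_ne_bot hU hne α)).ge ξ hξ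

/-- A supremum of affine functions of `α` is convex. The explicit bound also shows that the
conjugate stays finite along the segment. -/
theorem conjU_convexCombination_le (hU : ClosedProperConvex P.U) (hne : P.slackDom.Nonempty)
    {α β : P.Idx → ℝ} (hα : P.conjU α ≠ ⊤) (hβ : P.conjU β ≠ ⊤) {s : ℝ} (hs0 : 0 ≤ s)
    (hs1 : s ≤ 1) :
    P.conjU (α + s • (β - α)) ≤
      (((1 - s) * (P.conjU α).toReal + s * (P.conjU β).toReal : ℝ) : EReal) := by
  rw [conjU_le_coe_iff hU]
  intro ξ hξ
  have h1 := mul_le_mul_of_nonneg_left (le_toReal_conjU hU hne hα hξ) (sub_nonneg.2 hs1)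
  have h2 := mul_le_mul_of_nonneg_left (le_toReal_conjU hU hne hβ hξ) hs0
  have h3 : ∑ j : P.Idx, (α + s • (β - α)) j * ξ j.1 =
      (1 - s) * ∑ j : P.Idx, α j * ξ j.1 + s * ∑ j : P.Idx, β j * ξ j.1 := by
    rw [Finset.mul_sum, Finset.mul_sum, ← Finset.sum_add_distrib]
    refine Finset.sum_congr rfl fun j _ => ?_
    simp only [Pi.add_apply, Pi.smul_apply, Pi.sub_apply, smul_eq_mul]
    ring
  rw [h3]
  linarith

end Conjugate

section Dual

variable {α : P.Idx → ℝ}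

theorem finite_of_dualObjective_ne_bot (h : P.dualObjective α ≠ ⊥) :
    P.Z α ≠ ⊤ ∧ P.conjU α ≠ ⊤ := by
  constructor <;> intro h' <;> apply h <;> simp [dualObjective, h']

theorem dualObjective_eq_coe (hprior : IsProbabilityMeasure P.prior)
    (hF : ∀ x y, Measurable (P.F x y)) (hU : ClosedProperConvex P.U)
    (hne : P.slackDom.Nonempty) (hZ : P.Z α ≠ ⊤) (hc : P.conjU α ≠ ⊤) :
    P.dualObjective α = ((-P.logZ α - (P.conjU α).toReal : ℝ) : EReal) := by
  rw [dualObjective, log_Z hprior hF hZ]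
  conv_lhs => rw [← EReal.coe_toReal hc (conjU_ne_bot hU hne α)]
  push_cast
  rfl

theorem primalObjective_eq_coe (hU : ClosedProperConvex P.U) {p : Measure W}
    {ξ : Fin P.N → ℝ} (hkl : InformationTheory.klDiv p P.prior ≠ ⊤) (hξ : P.U ξ ≠ ⊤) :
    P.primalObjective p ξ =
      (((InformationTheory.klDiv p P.prior).toReal + (P.U ξ).toReal : ℝ) : EReal) := by
  rw [primalObjective]
  conv_lhs => rw [← hU.coe_toReal hξ, ← ENNReal.ofReal_toReal hkl]
  rw [EReal.coe_ennreal_ofReal, max_eq_left ENNReal.toReal_nonneg]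
  push_cast
  rfl

theorem finite_of_primalObjective_ne_top (hU : ClosedProperConvex P.U) {p : Measure W}
    {ξ : Fin P.N → ℝ} (h : P.primalObjective p ξ ≠ ⊤) :
    InformationTheory.klDiv p P.prior ≠ ⊤ ∧ P.U ξ ≠ ⊤ := by
  constructor <;> intro h' <;> apply h
  · simp [primalObjective, h', EReal.top_add_of_ne_bot (hU.ne_bot ξ)]
  · rw [primalObjective, h']
    exact EReal.add_top_of_ne_bot (EReal.coe_ennreal_ne_bot _)

/-- The duality gap is the sum of the divergence from the tilted prior, the Fenchel gap of
the slack function and the complementary slackness terms. -/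
theorem primal_sub_dual (hprior : IsProbabilityMeasure P.prior)
    (hF : ∀ x y, Measurable (P.F x y)) {p : Measure W} {ξ : Fin P.N → ℝ}
    (hp : P.Feasible p ξ) (hkl : InformationTheory.klDiv p P.prior ≠ ⊤) (hZ : P.Z α ≠ ⊤) :
    ((InformationTheory.klDiv p P.prior).toReal + (P.U ξ).toReal)
        - (-P.logZ α - (P.conjU α).toReal) =
      (InformationTheory.klDiv p (P.gibbs α)).toReal +
        ((P.conjU α).toReal - (∑ j : P.Idx, α j * ξ j.1 - (P.U ξ).toReal)) +
        ∑ j : P.Idx, α j * ((∫ w, P.gap j w ∂p) + ξ j.1) := by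
  have := hp.prob
  have h := (klDiv_tilted_right hkl (integrable_exponent hp.integrable α)
    (integrable_exp_exponent hF hZ)).2
  rw [gibbs_eq_tilted hprior hF hZ, h, integral_exponent hp.integrable, logZ]
  simp_rw [mul_add, Finset.sum_add_distrib]
  ring

theorem Feasible.slackness_nonneg {p : Measure W} {ξ : Fin P.N → ℝ} (hp : P.Feasible p ξ)
    (hα : ∀ j, 0 ≤ α j) (j : P.Idx) : 0 ≤ α j * ((∫ w, P.gap j w ∂p) + ξ j.1) :=
  mul_nonneg (hα j) (by linarith [hp.margin j])

/-- Infinite objectives are trivial; otherwise the three terms of `primal_sub_dual` are nonnegative.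
-/
theorem dualObjective_le_primalObjective (hprior : IsProbabilityMeasure P.prior)
    (hF : ∀ x y, Measurable (P.F x y)) (hU : ClosedProperConvex P.U)
    (hne : P.slackDom.Nonempty) (hα : ∀ j, 0 ≤ α j) {p : Measure W} {ξ : Fin P.N → ℝ}
    (hp : P.Feasible p ξ) : P.dualObjective α ≤ P.primalObjective p ξ := by
  by_cases hd : P.dualObjective α = ⊥
  · simp [hd]
  by_cases ht : P.primalObjective p ξ = ⊤
  · simp [ht]
  obtain ⟨hZ, hc⟩ := finite_of_dualObjective_ne_bot hd
  obtain ⟨hkl, hξ⟩ := finite_of_primalObjective_ne_top hU ht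
  rw [dualObjective_eq_coe hprior hF hU hne hZ hc, primalObjective_eq_coe hU hkl hξ,
    EReal.coe_le_coe_iff]
  have h1 := primal_sub_dual hprior hF (α := α) hp hkl hZ
  have h2 := le_toReal_conjU hU hne hc ⟨hp.nonneg, hξ⟩
  have h3 := Finset.sum_nonneg fun j (_ : j ∈ Finset.univ) => hp.slackness_nonneg hα j
  have h4 : 0 ≤ (InformationTheory.klDiv p (P.gibbs α)).toReal := ENNReal.toReal_nonneg
  linarith

theorem dualValue_le_primalValue (hprior : IsProbabilityMeasure P.prior)
    (hF : ∀ x y, Measurable (P.F x y)) (hU : ClosedProperConvex P.U)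
    (hne : P.slackDom.Nonempty) : P.dualValue ≤ P.primalValue := by
  refine iSup₂_le fun α hα => le_sInf ?_
  rintro v ⟨p, ξ, hp, rfl⟩
  exact dualObjective_le_primalObjective hprior hF hU hne hα hp

end Dual

/-! ### Strong duality through truncated densities -/

section Densities

variable {ρ : W → ℝ}

theorem integrable_gap_withDensity (hprior : IsProbabilityMeasure P.prior)
    (hF : ∀ x y, Measurable (P.F x y)) (hρ : ρ ∈ truncatedDensities P.prior P.gap) (j : P.Idx) :
    Integrable (P.gap j) (P.prior.withDensity fun w => ENNReal.ofReal (ρ w)) := by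
  have hm := hρ.1
  rw [integrable_withDensity_iff_integrable_smul' (by fun_prop) (by simp)]
  simpa only [ENNReal.toReal_ofReal (hρ.2.1 _), smul_eq_mul] using
    integrable_mul_truncatedDensity (measurable_gap hF) hρ j

theorem integral_gap_withDensity (hρ : ρ ∈ truncatedDensities P.prior P.gap) (j : P.Idx) :
    ∫ w, P.gap j w ∂(P.prior.withDensity fun w => ENNReal.ofReal (ρ w)) =
      ∫ w, ρ w * P.gap j w ∂P.prior := by
  have hm := hρ.1
  rw [integral_withDensity_eq_integral_toReal_smul (by fun_prop) (by simp)]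
  simp only [ENNReal.toReal_ofReal (hρ.2.1 _), smul_eq_mul]

theorem feasible_withDensity (hprior : IsProbabilityMeasure P.prior)
    (hF : ∀ x y, Measurable (P.F x y)) (hρ : ρ ∈ truncatedDensities P.prior P.gap)
    {ξ : Fin P.N → ℝ} (hξ : ∀ i, 0 ≤ ξ i)
    (h : ∀ j : P.Idx, -ξ j.1 ≤ ∫ w, ρ w * P.gap j w ∂P.prior) :
    P.Feasible (P.prior.withDensity fun w => ENNReal.ofReal (ρ w)) ξ where
  prob := ⟨by
    rw [withDensity_apply _ MeasurableSet.univ, setLIntegral_univ,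
      ← ofReal_integral_eq_lintegral_ofReal (integrable_truncatedDensity hρ)
        (ae_of_all _ hρ.2.1), hρ.2.2.1, ENNReal.ofReal_one]⟩
  integrable := integrable_gap_withDensity hprior hF hρ
  nonneg := hξ
  margin j := by
    rw [integral_gap_withDensity hρ]
    exact h j

theorem klDiv_withDensity_truncated (hprior : IsProbabilityMeasure P.prior)
    (hρ : ρ ∈ truncatedDensities P.prior P.gap) :
    InformationTheory.klDiv (P.prior.withDensity fun w => ENNReal.ofReal (ρ w)) P.prior =
      ENNReal.ofReal (∫ w, ρ w * Real.log (ρ w) ∂P.prior) := by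
  obtain ⟨hm, h0, h1, B, hB⟩ := hρ
  exact klDiv_withDensity_of_bounded hm h0 (fun w => (hB w).1) h1

theorem integral_mul_log_nonneg (hprior : IsProbabilityMeasure P.prior)
    (hρ : ρ ∈ truncatedDensities P.prior P.gap) :
    0 ≤ ∫ w, ρ w * Real.log (ρ w) ∂P.prior := by
  have hi := integrable_mul_log_truncatedDensity hρ
  have h1 := integrable_truncatedDensity hρ
  have h : 0 ≤ ∫ w, (ρ w * Real.log (ρ w) - (ρ w - 1)) ∂P.prior := by
    refine integral_nonneg fun w => ?_
    have := InformationTheory.klFun_nonneg (hρ.2.1 w)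
    rw [InformationTheory.klFun] at this
    simp only [Pi.zero_apply]
    linarith
  have h2 : Integrable (fun w => ρ w - 1) P.prior := h1.sub (integrable_const _)
  rw [integral_sub hi h2, integral_sub h1 (integrable_const _),
    hρ.2.2.1] at h
  simpa using h

/-- A density and a slack vector satisfying all the margin constraints strictly. -/
theorem exists_strictly_feasible (hprior : IsProbabilityMeasure P.prior)
    (hF : ∀ x y, Measurable (P.F x y))
    (hdom : ∀ M : ℝ, ∃ ξ : Fin P.N → ℝ, (∀ i, M ≤ ξ i) ∧ P.U ξ ≠ ⊤) :
    ∃ ρ ∈ truncatedDensities P.prior P.gap, ∃ ξ ∈ P.slackDom,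
      ∀ j : P.Idx, -ξ j.1 - ∫ w, ρ w * P.gap j w ∂P.prior < 0 := by
  obtain ⟨n₀, hn₀⟩ := exists_truncation_ne_zero (μ := P.prior) (measurable_gap hF)
  -- With multipliers `0` this density is the normalized restriction of the prior; the slack is then
  -- chosen to exceed the absolute value of every expected gap.
  obtain ⟨ρ, hρ, -⟩ := exists_truncatedDensity (measurable_gap hF) 0 n₀ (hn₀ n₀ le_rfl)
  obtain ⟨ξ, hξ, hfin⟩ := hdom (∑ j : P.Idx, |∫ w, ρ w * P.gap j w ∂P.prior| + 1)
  have hs : ∀ j : P.Idx, |∫ w, ρ w * P.gap j w ∂P.prior| ≤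
      ∑ j : P.Idx, |∫ w, ρ w * P.gap j w ∂P.prior| := fun j =>
    Finset.single_le_sum (f := fun j : P.Idx => |∫ w, ρ w * P.gap j w ∂P.prior|)
      (fun j _ => abs_nonneg _) (Finset.mem_univ j)
  refine ⟨ρ, hρ, ξ, ⟨fun i => le_trans (by positivity) (hξ i), hfin⟩, fun j => ?_⟩
  linarith [hs j, hξ j.1, neg_abs_le (∫ w, ρ w * P.gap j w ∂P.prior)]

theorem primalValue_ne_top (hprior : IsProbabilityMeasure P.prior)
    (hF : ∀ x y, Measurable (P.F x y)) (hU : ClosedProperConvex P.U)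
    (hdom : ∀ M : ℝ, ∃ ξ : Fin P.N → ℝ, (∀ i, M ≤ ξ i) ∧ P.U ξ ≠ ⊤) :
    P.primalValue ≠ ⊤ := by
  obtain ⟨ρ, hρ, ξ, hξ, hlt⟩ := exists_strictly_feasible hprior hF hdom
  have hp := feasible_withDensity hprior hF hρ hξ.1 fun j => by linarith [hlt j]
  have hle : P.primalValue ≤ _ := sInf_le ⟨_, ξ, hp, rfl⟩
  refine ne_top_of_le_ne_top ?_ hle
  rw [primalObjective_eq_coe hU _ hξ.2]
  · exact EReal.coe_ne_top _
  · rw [klDiv_withDensity_truncated hprior hρ]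
    exact ENNReal.ofReal_ne_top

/-- Strong duality: every real lower bound of the primal problem is attained by the dual. -/
theorem exists_le_dualObjective (hprior : IsProbabilityMeasure P.prior)
    (hF : ∀ x y, Measurable (P.F x y)) (hU : ClosedProperConvex P.U)
    (hdom : ∀ M : ℝ, ∃ ξ : Fin P.N → ℝ, (∀ i, M ≤ ξ i) ∧ P.U ξ ≠ ⊤) {v : ℝ}
    (hv : (v : EReal) ≤ P.primalValue) :
    ∃ α : P.Idx → ℝ, (∀ j, 0 ≤ α j) ∧ (v : EReal) ≤ P.dualObjective α := by
  have hg := measurable_gap hF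
  set D := truncatedDensities P.prior P.gap with hD
  have hC : Convex ℝ (D ×ˢ P.slackDom) := convex_truncatedDensities.prod hU.convexOn_toReal.1
  have hf : ConvexOn ℝ (D ×ˢ P.slackDom)
      (fun q => ∫ w, q.1 w * Real.log (q.1 w) ∂P.prior + (P.U q.2).toReal) := by
    refine ⟨hC, fun q hq r hr a b ha hb hab => ?_⟩
    have h1 := convexOn_integral_mul_log.2 hq.1 hr.1 ha hb hab
    have h2 := hU.convexOn_toReal.2 hq.2 hr.2 ha hb hab
    simp only [Prod.fst_add, Prod.snd_add, Prod.smul_fst, Prod.smul_snd, smul_eq_mul] at h1 h2 ⊢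
    linarith
  have hh : ∀ j : P.Idx, ConvexOn ℝ (D ×ˢ P.slackDom)
      (fun q => -q.2 j.1 - ∫ w, q.1 w * P.gap j w ∂P.prior) := by
    refine fun j => ⟨hC, fun q hq r hr a b ha hb hab => le_of_eq ?_⟩
    have h1 := integral_mul_of_convexCombination hg hq.1 hr.1 a b j
    simp only [Prod.fst_add, Prod.snd_add, Prod.smul_fst, Prod.smul_snd, smul_eq_mul] at h1 ⊢
    rw [h1]
    simp only [Pi.add_apply, Pi.smul_apply, smul_eq_mul]
    ring
  obtain ⟨ρ₀, hρ₀, ξ₀, hξ₀, hlt⟩ := exists_strictly_feasible hprior hF hdom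
  obtain ⟨α, hα, hle⟩ := exists_lagrange_multipliers hf hh (x₀ := (ρ₀, ξ₀)) ⟨hρ₀, hξ₀⟩ hlt (v := v)
    (by
      rintro ⟨ρ, ξ⟩ ⟨hρ, hξ⟩ hq
      have hp := feasible_withDensity hprior hF hρ hξ.1 fun j => by linarith [hq j]
      have h1 : P.primalValue ≤ _ := sInf_le ⟨_, ξ, hp, rfl⟩
      have h2 := klDiv_withDensity_truncated hprior hρ
      have h3 := hv.trans h1
      rw [primalObjective_eq_coe hU (by rw [h2]; exact ENNReal.ofReal_ne_top) hξ.2, h2,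
        ENNReal.toReal_ofReal (integral_mul_log_nonneg hprior hρ)] at h3
      exact_mod_cast h3)
  obtain ⟨n₀, hn₀⟩ := exists_truncation_ne_zero (μ := P.prior) hg
  -- For the truncated tilted density the expected gaps cancel between entropy and constraint terms,
  -- so only `-log z` remains. The resulting bound on `z` does not depend on `n`.
  have hbound : ∀ ξ ∈ P.slackDom, P.Z α ≤
      ENNReal.ofReal (Real.exp ((P.U ξ).toReal - ∑ j : P.Idx, α j * ξ j.1 - v)) := by
    intro ξ hξ
    refine lintegral_le_of_forall_truncation hg (n₀ := n₀) fun n hn => ?_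
    obtain ⟨ρ, hρ, hpos, heq, hent⟩ := exists_truncatedDensity hg α n (hn₀ n hn)
    have h := hle (ρ, ξ) ⟨hρ, hξ⟩
    simp only at h
    rw [hent] at h
    refine heq.symm.trans_le (ENNReal.ofReal_le_ofReal ?_)
    rw [← Real.log_le_iff_le_exp hpos]
    have hsum : ∑ j : P.Idx, α j * (-ξ j.1 - ∫ w, ρ w * P.gap j w ∂P.prior) =
        -∑ j : P.Idx, α j * ξ j.1 - ∑ j : P.Idx, α j * ∫ w, ρ w * P.gap j w ∂P.prior := by
      rw [← Finset.sum_neg_distrib, ← Finset.sum_sub_distrib]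
      exact Finset.sum_congr rfl fun j _ => by ring
    rw [hsum] at h
    linarith
  have hZ : P.Z α ≠ ⊤ := ne_top_of_le_ne_top ENNReal.ofReal_ne_top (hbound ξ₀ hξ₀)
  -- Read for fixed `α` and varying `ξ`, the same bound controls the supremum defining the
  -- conjugate.
  have hconj : P.conjU α ≤ ((-v - P.logZ α : ℝ) : EReal) := by
    rw [conjU_le_coe_iff hU]
    intro ξ hξ
    have h := hbound ξ hξ
    rw [Z_eq_ofReal hF hZ, ENNReal.ofReal_le_ofReal_iff (Real.exp_pos _).le,
      ← Real.log_le_iff_le_exp (integral_exp_exponent_pos hprior hF hZ)] at h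
    rw [logZ]
    linarith
  have hc : P.conjU α ≠ ⊤ := ne_top_of_le_ne_top (EReal.coe_ne_top _) hconj
  refine ⟨α, hα, ?_⟩
  rw [dualObjective_eq_coe hprior hF hU ⟨ξ₀, hξ₀⟩ hZ hc, EReal.coe_le_coe_iff]
  rw [← EReal.coe_toReal hc (conjU_ne_bot hU ⟨ξ₀, hξ₀⟩ α), EReal.coe_le_coe_iff] at hconj
  linarith

/-- Comparing with real numbers below the primal value also covers the value `⊥`, which has none. -/
theorem primalValue_eq_dualValue (hprior : IsProbabilityMeasure P.prior)
    (hF : ∀ x y, Measurable (P.F x y)) (hU : ClosedProperConvex P.U)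
    (hdom : ∀ M : ℝ, ∃ ξ : Fin P.N → ℝ, (∀ i, M ≤ ξ i) ∧ P.U ξ ≠ ⊤) :
    P.primalValue = P.dualValue := by
  refine le_antisymm (EReal.ge_of_forall_gt_iff_ge.1 fun v hv => ?_)
    (dualValue_le_primalValue hprior hF hU (slackDom_nonempty hdom))
  obtain ⟨α, hα, hle⟩ := exists_le_dualObjective hprior hF hU hdom hv.le
  exact hle.trans (le_iSup₂_of_le α hα le_rfl)

/-- The optimal value is itself a real lower bound, so its multipliers attain the dual supremum
without a compactness argument. -/
theorem exists_isDualSolution (hprior : IsProbabilityMeasure P.prior)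
    (hF : ∀ x y, Measurable (P.F x y)) (hU : ClosedProperConvex P.U)
    (hdom : ∀ M : ℝ, ∃ ξ : Fin P.N → ℝ, (∀ i, M ≤ ξ i) ∧ P.U ξ ≠ ⊤)
    (hbot : P.primalValue ≠ ⊥) : ∃ α, P.IsDualSolution α := by
  have hcoe := EReal.coe_toReal (primalValue_ne_top hprior hF hU hdom) hbot
  obtain ⟨α, hα, hle⟩ := exists_le_dualObjective hprior hF hU hdom hcoe.le
  refine ⟨α, hα, ne_bot_of_le_ne_bot (EReal.coe_ne_bot _) hle, fun β hβ => ?_⟩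
  refine le_trans ?_ (hcoe.symm.le.trans hle)
  exact (le_iSup₂_of_le β hβ le_rfl).trans
    (dualValue_le_primalValue hprior hF hU (slackDom_nonempty hdom))

theorem IsDualSolution.dualObjective_eq {α : P.Idx → ℝ} (h : P.IsDualSolution α) :
    P.dualObjective α = P.dualValue :=
  le_antisymm (le_iSup₂_of_le α h.1 le_rfl) (iSup₂_le h.2.2)

theorem IsPrimalSolution.primalObjective_eq {p : Measure W} {ξ : Fin P.N → ℝ}
    (h : P.IsPrimalSolution p ξ) : P.primalObjective p ξ = P.primalValue := by
  refine le_antisymm (le_sInf ?_) (sInf_le ⟨p, ξ, h.1, rfl⟩)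
  rintro v ⟨p', ξ', hp', rfl⟩
  exact h.2 p' ξ' hp'

end Densities

end MaxEnDNet

/-! ### Optimality conditions and recovery of primal solutions -/

namespace MaxEnDNet

variable {X Y W : Type*} [MeasurableSpace W] {P : MaxEnDNet X Y W}

/-- The optimality conditions for a pair of primal and dual solutions. -/
theorem IsPrimalSolution.eq_gibbs (hprior : IsProbabilityMeasure P.prior)
    (hF : ∀ x y, Measurable (P.F x y)) (hU : ClosedProperConvex P.U)
    (hdom : ∀ M : ℝ, ∃ ξ : Fin P.N → ℝ, (∀ i, M ≤ ξ i) ∧ P.U ξ ≠ ⊤)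
    {p : Measure W} {ξ : Fin P.N → ℝ} {α : P.Idx → ℝ}
    (hpξ : P.IsPrimalSolution p ξ) (hα : P.IsDualSolution α) :
    P.Z α ≠ ⊤ ∧ p = P.gibbs α ∧
      ∀ j : P.Idx, α j * ((∫ w, P.gap j w ∂p) + ξ j.1) = 0 := by
  have hne := slackDom_nonempty hdom
  obtain ⟨hZ, hc⟩ := finite_of_dualObjective_ne_bot hα.2.1
  have heq : P.primalObjective p ξ = P.dualObjective α := by
    rw [hpξ.primalObjective_eq, hα.dualObjective_eq,
      primalValue_eq_dualValue hprior hF hU hdom]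
  obtain ⟨hkl, hξ⟩ := finite_of_primalObjective_ne_top hU
    (hpξ.primalObjective_eq.trans_ne (primalValue_ne_top hprior hF hU hdom))
  rw [dualObjective_eq_coe hprior hF hU hne hZ hc, primalObjective_eq_coe hU hkl hξ,
    EReal.coe_eq_coe_iff] at heq
  have h1 := primal_sub_dual hprior hF (α := α) hpξ.1 hkl hZ
  have h2 := le_toReal_conjU hU hne hc ⟨hpξ.1.nonneg, hξ⟩
  have hnn := fun j (_ : j ∈ Finset.univ) => hpξ.1.slackness_nonneg hα.1 j
  have h3 := Finset.sum_nonneg hnn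
  have h4 : 0 ≤ (InformationTheory.klDiv p (P.gibbs α)).toReal := ENNReal.toReal_nonneg
  refine ⟨hZ, ?_, fun j => (Finset.sum_eq_zero_iff_of_nonneg hnn).1 (by linarith) j
    (Finset.mem_univ j)⟩
  have h5 : (InformationTheory.klDiv p (P.gibbs α)).toReal = 0 := by linarith
  have := hpξ.1.prob
  have hexp := integrable_exp_exponent hF hZ
  -- Finiteness is needed because `toReal` also sends an infinite divergence to `0`.
  have hfin := (klDiv_tilted_right hkl (integrable_exponent hpξ.1.integrable α) hexp).1
  rw [gibbs_eq_tilted hprior hF hZ] at h5 ⊢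
  have := isProbabilityMeasure_tilted hexp
  exact InformationTheory.klDiv_eq_zero_iff.1
    (((ENNReal.toReal_eq_zero_iff _).1 h5).resolve_right hfin)

section Coercive

theorem CoerciveSlack.exists_linear_growth (hU : ClosedProperConvex P.U)
    (hne : P.slackDom.Nonempty) (hc : P.CoerciveSlack) :
    ∃ ε > 0, ∃ b : ℝ, ∀ ξ ∈ P.slackDom, ε * ‖ξ‖ - b ≤ (P.U ξ).toReal := by
  obtain ⟨ξ₀, h0, hfin⟩ := hne
  obtain ⟨ε, hε, b, h⟩ := hU.exists_linear_growth hc h0 hfin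
  exact ⟨ε, hε, b, fun ξ hξ => h ξ hξ.1 hξ.2⟩

theorem CoerciveSlack.primalValue_ne_bot (hU : ClosedProperConvex P.U)
    (hne : P.slackDom.Nonempty) (hc : P.CoerciveSlack) : P.primalValue ≠ ⊥ := by
  obtain ⟨ε, hε, b, h⟩ := hc.exists_linear_growth hU hne
  have hle : ((-b : ℝ) : EReal) ≤ P.primalValue := by
    refine le_sInf ?_
    rintro v ⟨p, ξ, hp, rfl⟩
    by_cases ht : P.primalObjective p ξ = ⊤
    · simp [ht]
    obtain ⟨hkl, hξ⟩ := finite_of_primalObjective_ne_top hU ht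
    rw [primalObjective_eq_coe hU hkl hξ, EReal.coe_le_coe_iff]
    have h1 := h ξ ⟨hp.nonneg, hξ⟩
    have h2 : 0 ≤ ε * ‖ξ‖ := by positivity
    have h3 : 0 ≤ (InformationTheory.klDiv p P.prior).toReal := ENNReal.toReal_nonneg
    linarith
  exact ne_bot_of_le_ne_bot (EReal.coe_ne_bot _) hle

/-- The conjugate of a coercive slack function is finite at zero and at small multiples of the
coordinate vectors. -/
theorem CoerciveSlack.conjU_ne_top (hU : ClosedProperConvex P.U)
    (hne : P.slackDom.Nonempty) (hc : P.CoerciveSlack) [DecidableEq P.Idx] :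
    P.conjU 0 ≠ ⊤ ∧ ∃ ε > 0, ∀ j : P.Idx, P.conjU (Pi.single j ε) ≠ ⊤ := by
  obtain ⟨ε, hε, b, h⟩ := hc.exists_linear_growth hU hne
  constructor
  · refine ne_top_of_le_ne_top (EReal.coe_ne_top b) ((conjU_le_coe_iff hU).2 fun ξ hξ => ?_)
    have h1 := h ξ hξ
    have h2 : 0 ≤ ε * ‖ξ‖ := by positivity
    simp only [Pi.zero_apply, zero_mul, Finset.sum_const_zero]
    linarith
  · refine ⟨ε, hε, fun i => ?_⟩
    refine ne_top_of_le_ne_top (EReal.coe_ne_top b) ((conjU_le_coe_iff hU).2 fun ξ hξ => ?_)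
    have h1 := h ξ hξ
    have h2 : ε * ξ i.1 ≤ ε * ‖ξ‖ :=
      mul_le_mul_of_nonneg_left ((le_abs_self _).trans (norm_le_pi_norm ξ i.1)) hε.le
    have h3 : ∑ j : P.Idx, (Pi.single i ε : P.Idx → ℝ) j * ξ j.1 = ε * ξ i.1 := by
      simp [Pi.single_apply]
    rw [h3]
    linarith

end Coercive

section Regular

variable {α β : P.Idx → ℝ}

/-- If `Z` is regular, then it is finite on an initial piece of every segment from a point of its
domain into the nonnegative orthant. -/
theorem RegularZ.exists_segment (hreg : P.RegularZ) (hα : ∀ j, 0 ≤ α j) (hZ : P.Z α ≠ ⊤)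
    (hβ : ∀ j, 0 ≤ β j) :
    ∃ s₀ : ℝ, 0 < s₀ ∧ s₀ ≤ 1 ∧ ∀ s : ℝ, 0 < s → s ≤ s₀ → P.Z (α + s • (β - α)) ≠ ⊤ := by
  have hlim : Filter.Tendsto (fun s : ℝ => α + s • (β - α)) (𝓝[Set.Icc 0 1] 0)
      (𝓝[{β : P.Idx → ℝ | ∀ j, 0 ≤ β j}] α) := by
    refine tendsto_nhdsWithin_iff.2 ⟨?_, ?_⟩
    · have : Continuous fun s : ℝ => α + s • (β - α) := by fun_prop
      simpa using (this.tendsto 0).mono_left nhdsWithin_le_nhds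
    · filter_upwards [self_mem_nhdsWithin] with s hs j
      have h1 := mul_nonneg (sub_nonneg.2 hs.2) (hα j)
      have h2 := mul_nonneg hs.1 (hβ j)
      simp only [Pi.add_apply, Pi.smul_apply, Pi.sub_apply, smul_eq_mul]
      linarith
  have hev := hlim.eventually (hreg α hα hZ)
  obtain ⟨δ, hδ, h⟩ := Metric.eventually_nhds_iff.1 (eventually_nhdsWithin_iff.1 hev)
  refine ⟨min (δ / 2) 1, by positivity, min_le_right _ _, fun s h0 hs => h ?_ ⟨h0.le, ?_⟩⟩
  · rw [Real.dist_eq, sub_zero, abs_of_pos h0]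
    linarith [hs.trans (min_le_left _ _)]
  · exact hs.trans (min_le_right _ _)

theorem exponent_segment (s : ℝ) (w : W) :
    P.exponent (α + s • (β - α)) w =
      P.exponent α w + s * (P.exponent β w - P.exponent α w) := by
  simp only [exponent, ← Finset.sum_sub_distrib, Finset.mul_sum, ← Finset.sum_add_distrib]
  refine Finset.sum_congr rfl fun j _ => ?_
  simp only [Pi.add_apply, Pi.smul_apply, Pi.sub_apply, smul_eq_mul]
  ring

/-- The first order optimality condition at a solution of the dual problem, with the integrability
of the directional derivative. -/
theorem IsDualSolution.integrable_and_le (hprior : IsProbabilityMeasure P.prior)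
    (hF : ∀ x y, Measurable (P.F x y)) (hU : ClosedProperConvex P.U)
    (hne : P.slackDom.Nonempty) (hreg : P.RegularZ) (hα : P.IsDualSolution α)
    (hβ : ∀ j, 0 ≤ β j) (hcβ : P.conjU β ≠ ⊤) :
    Integrable (fun w => P.exponent β w - P.exponent α w) (P.gibbs α) ∧
      -((P.conjU β).toReal - (P.conjU α).toReal) ≤
        ∫ w, (P.exponent β w - P.exponent α w) ∂(P.gibbs α) := by
  obtain ⟨hZ, hcα⟩ := finite_of_dualObjective_ne_bot hα.2.1
  obtain ⟨s₀, hs₀, hs₁, hseg⟩ := hreg.exists_segment hα.1 hZ hβ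
  have hexp := integrable_exp_exponent hF hZ
  have hmα := measurable_exponent hF α
  have hmβ := measurable_exponent hF β
  have hprob := isProbabilityMeasure_tilted hexp
  rw [gibbs_eq_tilted hprior hF hZ]
  have hpt : ∀ s w, Real.exp (P.exponent α w) *
      Real.exp (s * (P.exponent β w - P.exponent α w)) =
        Real.exp (P.exponent (α + s • (β - α)) w) := fun s w => by
    rw [exponent_segment, Real.exp_add]
  -- Here `K` is the increment of the conjugate from `α` to `β`. The integral of `exp (s d)` is a
  -- ratio of normalization factors; optimality of `α` and convexity of the conjugate bound its
  -- logarithm below by `-s K`, and `1 + x ≤ exp x` finishes.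
  refine integrable_of_le_integral_exp (hmβ.sub hmα) hs₀ (fun s h0 hs => ?_) fun s h0 hs => ?_
  · rw [integrable_tilted_iff hexp]
    simp only [smul_eq_mul, Pi.sub_apply, hpt]
    exact integrable_exp_exponent hF (hseg s h0 hs)
  · have hZs := hseg s h0 hs
    have hpos := integral_exp_exponent_pos hprior hF hZ
    have hposs := integral_exp_exponent_pos hprior hF hZs
    have hconv := conjU_convexCombination_le hU hne hcα hcβ h0.le (hs.trans hs₁)
    have hcs := ne_top_of_le_ne_top (EReal.coe_ne_top _) hconv
    rw [← EReal.coe_toReal hcs (conjU_ne_bot hU hne _), EReal.coe_le_coe_iff] at hconv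
    have hopt := hα.2.2 (α + s • (β - α)) fun j => by
      have h1 := mul_nonneg (sub_nonneg.2 (hs.trans hs₁)) (hα.1 j)
      have h2 := mul_nonneg h0.le (hβ j)
      simp only [Pi.add_apply, Pi.smul_apply, Pi.sub_apply, smul_eq_mul]
      linarith
    rw [dualObjective_eq_coe hprior hF hU hne hZ hcα,
      dualObjective_eq_coe hprior hF hU hne hZs hcs, EReal.coe_le_coe_iff] at hopt
    have hratio : ∫ w, Real.exp (s * (P.exponent β w - P.exponent α w))
        ∂(P.prior.tilted (P.exponent α)) = Real.exp (P.logZ (α + s • (β - α)) - P.logZ α) := by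
      rw [integral_exp_tilted, logZ, logZ, Real.exp_sub, Real.exp_log hpos, Real.exp_log hposs]
      simp only [exponent_segment, Pi.add_apply]
    simp only [Pi.sub_apply]
    rw [hratio]
    have := Real.add_one_le_exp (P.logZ (α + s • (β - α)) - P.logZ α)
    linarith

/-- Subtracting the directional derivative toward `0` from the one toward `ε` times a coordinate
vector leaves `ε` times a single gap. -/
theorem IsDualSolution.integrable_gap (hprior : IsProbabilityMeasure P.prior)
    (hF : ∀ x y, Measurable (P.F x y)) (hU : ClosedProperConvex P.U)
    (hne : P.slackDom.Nonempty) (hc : P.CoerciveSlack) (hreg : P.RegularZ)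
    (hα : P.IsDualSolution α) (i : P.Idx) : Integrable (P.gap i) (P.gibbs α) := by
  classical
  obtain ⟨hc0, ε, hε, hcε⟩ := hc.conjU_ne_top hU hne
  have h1 := (hα.integrable_and_le hprior hF hU hne hreg (β := 0) (fun _ => le_rfl) hc0).1
  have h2 := (hα.integrable_and_le hprior hF hU hne hreg (β := Pi.single i ε)
    (fun j => (Pi.single_nonneg (α := fun _ : P.Idx => ℝ)).2 hε.le j) (hcε i)).1
  refine ((h2.sub h1).const_mul ε⁻¹).congr (ae_of_all _ fun w => ?_)
  have h3 : P.exponent (Pi.single i ε) w = ε * P.gap i w := by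
    simp [exponent, Pi.single_apply]
  have h4 : P.exponent 0 w = 0 := by simp [exponent]
  simp only [Pi.sub_apply, h3, h4]
  field_simp
  ring

theorem IsDualSolution.exists_isPrimalSolution (hprior : IsProbabilityMeasure P.prior)
    (hF : ∀ x y, Measurable (P.F x y)) (hU : ClosedProperConvex P.U)
    (hdom : ∀ M : ℝ, ∃ ξ : Fin P.N → ℝ, (∀ i, M ≤ ξ i) ∧ P.U ξ ≠ ⊤)
    (hc : P.CoerciveSlack) (hreg : P.RegularZ) (hα : P.IsDualSolution α) :
    ∃ ξ, P.IsPrimalSolution (P.gibbs α) ξ := by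
  have hne := slackDom_nonempty hdom
  obtain ⟨hZ, hcα⟩ := finite_of_dualObjective_ne_bot hα.2.1
  have hexp := integrable_exp_exponent hF hZ
  have hint := hα.integrable_gap hprior hF hU hne hc hreg
  set g : P.Idx → ℝ := fun j => ∫ w, P.gap j w ∂(P.gibbs α) with hg
  obtain ⟨ξ₀, hξ₀, hfin₀⟩ := hdom (∑ j, |g j| + 1)
  have hslater : ∀ j : P.Idx, -g j - ξ₀ j.1 < 0 := fun j => by
    have := Finset.single_le_sum (f := fun j => |g j|) (fun j _ => abs_nonneg _)
      (Finset.mem_univ j)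
    linarith [neg_abs_le (g j), hξ₀ j.1]
  have hξ₀nn : ∀ i, 0 ≤ ξ₀ i := fun i => le_trans (by positivity) (hξ₀ i)
  -- With the distribution fixed at `p_α`, the best slack minimizes `U` under the margins `g`.
  obtain ⟨ξ, ⟨hξnn, hξg⟩, hξfin, hξmin⟩ := hU.exists_isMinOn hc
    (S := {ξ | (∀ i, 0 ≤ ξ i) ∧ ∀ j : P.Idx, -g j ≤ ξ j.1})
    (by
      simp only [Set.ofPred_and, Set.ofPred_forall]
      exact (isClosed_iInter fun i => isClosed_le continuous_const (continuous_apply i)).inter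
        (isClosed_iInter fun j => isClosed_le continuous_const (continuous_apply _)))
    (fun η hη => hη.1) ⟨hξ₀nn, fun j => by linarith [hslater j]⟩ hfin₀
  obtain ⟨β, hβ, hlag⟩ := exists_lagrange_multipliers (J := P.Idx) hU.convexOn_toReal
    (h := fun j η => -g j - η j.1)
    (fun j => ⟨hU.convexOn_toReal.1, fun η _ θ _ a b _ _ hab => le_of_eq (by
      simp only [Pi.add_apply, Pi.smul_apply, smul_eq_mul]
      linear_combination (-g j) * hab.symm)⟩)
    (x₀ := ξ₀) ⟨hξ₀nn, hfin₀⟩ hslater (v := (P.U ξ).toReal)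
    (fun η hη hηg => EReal.toReal_le_toReal
      (hξmin η ⟨hη.1, fun j => by linarith [hηg j]⟩) (hU.ne_bot ξ) hη.2)
  have hconj : P.conjU β ≤ ((-(P.U ξ).toReal - ∑ j, β j * g j : ℝ) : EReal) := by
    rw [conjU_le_coe_iff hU]
    intro η hη
    have h := hlag η hη
    have hsum : ∑ j : P.Idx, β j * (-g j - η j.1) =
        -∑ j, β j * g j - ∑ j : P.Idx, β j * η j.1 := by
      rw [← Finset.sum_neg_distrib, ← Finset.sum_sub_distrib]
      exact Finset.sum_congr rfl fun j _ => by ring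
    rw [hsum] at h
    linarith
  have hcβ := ne_top_of_le_ne_top (EReal.coe_ne_top _) hconj
  rw [← EReal.coe_toReal hcβ (conjU_ne_bot hU hne β), EReal.coe_le_coe_iff] at hconj
  -- Together with `hconj`, moving toward the multipliers `β` gives `∑ α_j g_j + U⋆(α) ≤ -U(ξ)`,
  -- which is the missing half of the zero gap.
  have hopt := (hα.integrable_and_le hprior hF hU hne hreg hβ hcβ).2
  rw [integral_sub (integrable_exponent hint β) (integrable_exponent hint α),
    integral_exponent hint, integral_exponent hint] at hopt
  have hgibbs := gibbs_eq_tilted hprior hF hZ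
  have hprob : IsProbabilityMeasure (P.gibbs α) := hgibbs ▸ isProbabilityMeasure_tilted hexp
  obtain ⟨hkl, hkl'⟩ := klDiv_tilted_left hexp (hgibbs ▸ integrable_exponent hint α)
  rw [← hgibbs] at hkl hkl'
  rw [integral_exponent hint] at hkl'
  refine ⟨ξ, ⟨hprob, hint, hξnn, fun j => by linarith [hξg j]⟩, fun p' ξ' hp' => ?_⟩
  refine le_trans ?_ (dualObjective_le_primalObjective hprior hF hU hne hα.1 hp')
  rw [primalObjective_eq_coe hU hkl hξfin, dualObjective_eq_coe hprior hF hU hne hZ hcα,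
    EReal.coe_le_coe_iff, hkl', ← logZ]
  linarith

end Regular

end MaxEnDNet

theorem theorem2 {X Y W : Type*} [MeasurableSpace W] (P : MaxEnDNet X Y W)
    (hprior : IsProbabilityMeasure P.prior)
    (hF : ∀ x y, Measurable (P.F x y))
    (hU : ClosedProperConvex P.U)
    (hdom : ∀ M : ℝ, ∃ ξ : Fin P.N → ℝ, (∀ i, M ≤ ξ i) ∧ P.U ξ ≠ ⊤) :
    -- there is no duality gap, and the dual problem is solvable when its value is finite
    P.primalValue = P.dualValue ∧
    (P.primalValue ≠ ⊥ → ∃ α, P.IsDualSolution α) ∧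
    -- every solution of the primal problem is the tilted prior, for every solution of the dual,
    -- and the dual solution is a vector of multipliers for the margin constraints
    (∀ p ξ α, P.IsPrimalSolution p ξ → P.IsDualSolution α →
      P.Z α ≠ ⊤ ∧ p = P.gibbs α ∧
        ∀ j : P.Idx, α j * ((∫ w, P.gap j w ∂p) + ξ j.1) = 0) ∧
    -- both problems are solvable, and every solution of the dual yields one of the primal
    (P.CoerciveSlack → P.RegularZ →
      (∃ α, P.IsDualSolution α) ∧
      ∀ α, P.IsDualSolution α → ∃ ξ, P.IsPrimalSolution (P.gibbs α) ξ) := by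
  exact ⟨MaxEnDNet.primalValue_eq_dualValue hprior hF hU hdom,
    MaxEnDNet.exists_isDualSolution hprior hF hU hdom,
    fun _ _ _ hp hα => hp.eq_gibbs hprior hF hU hdom hα,
    fun hc hreg => ⟨MaxEnDNet.exists_isDualSolution hprior hF hU hdom
      (hc.primalValue_ne_bot hU (MaxEnDNet.slackDom_nonempty hdom)),
      fun _ hα => hα.exists_isPrimalSolution hprior hF hU hdom hc hreg⟩⟩
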